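/- Let $b\ge 2$, $d\ge 1$ and $t\ge 0$ be integers. An elementary interval in base $b$ is a set $\prod_{j=1}^d\bigl[c_jb^{-k_j},(c_j+1)b^{-k_j}\bigr)$ with integers $k_j\ge 0$ and $0\le c_j<b^{k_j}$; write $|\boldsymbol k|=\sum_j k_j$. For $m\ge t$, a list of $b^m$ points of $[0,1)^d$ is a $(t,m,d)$-net in base $b$ if every elementary interval with $|\boldsymbol k|\le m-t$ contains exactly $b^{m-|\boldsymbol k|}$ of them (with multiplicity). Points $\boldsymbol a_1,\boldsymbol a_2,\dots\in[0,1)^d$ form a $(t,d)$-sequence in base $b$ if for all integers $m\ge t$ and $r\ge 1$ the block $\boldsymbol a_{(r-1)b^m+1},\dots,\boldsymbol a_{rb^m}$ is a $(t,m,d)$-net in base $b$. The gain coefficients of points $\boldsymbol a_1,\dots,\boldsymbol a_n\in[0,1)^d$ are, for $\emptyset\ne u\subseteq\{1,\dots,d\}$ and integers $\kappa_j\ge 0$ $(j\in u)$, $$\Gamma_{u,\kappa}=\frac{1}{n(b-1)^{|u|}}\sum_{i=1}^n\sum_{i'=1}^n\prod_{j\in u}\Bigl(b\,\mathbf 1\{\lfloor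 b^{\kappa_j+1}a_{ij}\rfloor=\lfloor b^{\kappa_j+1}a_{i'j}\rfloor\}-\mathbf 1\{\lfloor b^{\kappa_j}a_{ij}\rfloor=\lfloor b^{\kappa_j}a_{i'j}\rfloor\}\Bigr).$$ The nested uniform scramble uses mutually independent random permutations $\pi_{j,s}$ of $\{0,\dots,b-1\}$, one for each coordinate $j$ and each finite (possibly empty) string $s$ of base $b$ digits, each uniformly distributed over the $b!$ permutations. If $a_{ij}=\sum_{k\ge1}a_{ijk}b^{-k}$ with digits $a_{ijk}=\lfloor b^ka_{ij}\rfloor \bmod b$, then the scrambled point $\boldsymbol x_i$ has coordinates $x_{ij}=\sum_{k\ge 1}x_{ijk}b^{-k}$ with $x_{ijk}=\pi_{j,(a_{ij1},\dots,a_{ij,k-1})}(a_{ijk})$; the same permutations are used for all $i$. **Theorem.** Let $\boldsymbol a_1,\boldsymbol a_2,\dots$ be a $(t,d)$-sequence in base $b$ such that, for some $\Gamma<\infty$, all gain coefficients of all the $(t,m,d)$-nets $\boldsymbol a_{(r-1)b^m+1},\dots,\boldsymbol a_{rb^m}$ ($m\ge t$, $r\ge 1$) are at most $\Gamma$, and let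 $\boldsymbol x_1,\boldsymbol x_2,\dots$ be its nested uniform scramble. Let $p>1$ be real and let $f:[0,1]^d\to\mathbb R$ belong to $L^p[0,1]^d$, with $\int_{[0,1]^d}f(\boldsymbol x)\,\mathrm d\boldsymbol x=\mu$. Then $$\Pr\Bigl(\lim_{n\to\infty}\frac1n\sum_{i=1}^nf(\boldsymbol x_i)=\mu\Bigr)=1,$$ where $n$ tends to infinity through all positive integers. -/

import Mathlib

open MeasureTheory ProbabilityTheory Filter Topology
open scoped ENNReal Nat

namespace ScrambledNet

/-- The elementary interval in base `b`
`E(k, c) = ∏ j, [c j / b ^ k j, (c j + 1) / b ^ k j)`. -/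
def elementaryInterval (b : ℕ) {d : ℕ} (k c : Fin d → ℕ) : Set (Fin d → ℝ) :=
  {x | ∀ j, x j ∈ Set.Ico ((c j : ℝ) / (b : ℝ) ^ k j) (((c j : ℝ) + 1) / (b : ℝ) ^ k j)}

/-- The `b ^ m` points `a i ∈ [0,1)^d` form a `(t, m, d)`-net in base `b`: every elementary
interval `E(k, c)` with `|k| ≤ m - t` contains exactly `b ^ (m - |k|)` of them, counted with
multiplicity. -/
def IsNet (b t m d : ℕ) (a : Fin (b ^ m) → Fin d → ℝ) : Prop :=
  t ≤ m ∧ (∀ i j, a i j ∈ Set.Ico (0 : ℝ) 1) ∧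
    ∀ k c : Fin d → ℕ, ∑ j, k j ≤ m - t → (∀ j, c j < b ^ k j) →
      Nat.card {i : Fin (b ^ m) // a i ∈ elementaryInterval b k c} = b ^ (m - ∑ j, k j)

/-- The `r`-th block (`r = 0, 1, 2, …`) of `b ^ m` consecutive points of a sequence of points
(which is indexed from `0`). -/
def block (b m r : ℕ) {d : ℕ} (a : ℕ → Fin d → ℝ) : Fin (b ^ m) → Fin d → ℝ :=
  fun i => a (r * b ^ m + i)

/-- The points `a i ∈ [0,1)^d` form a `(t, d)`-sequence in base `b`: for every `m ≥ t`, each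
block of `b ^ m` consecutive points starting at a multiple of `b ^ m` is a `(t, m, d)`-net. -/
def IsDigitalSequence (b t d : ℕ) (a : ℕ → Fin d → ℝ) : Prop :=
  (∀ i j, a i j ∈ Set.Ico (0 : ℝ) 1) ∧
    ∀ m, t ≤ m → ∀ r, IsNet b t m d (block b m r a)

open scoped Classical in
/-- The gain coefficient `Γ_{u, κ}` in base `b` of `n` points of `[0,1)^d`, for a set `u` of
coordinates and resolutions `κ j`, `j ∈ u`:
`(1 / (n (b-1)^|u|)) ∑ i, ∑ i', ∏ j ∈ u, (b 1{⌊b^(κ j + 1) a i j⌋ = ⌊b^(κ j + 1) a i' j⌋}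
- 1{⌊b^(κ j) a i j⌋ = ⌊b^(κ j) a i' j⌋})`.
It is the ratio of the variance of the average over the scrambled points to the variance of the
average over `n` independent uniform points, for integrands that belong to the `(u, κ)` part of
the base `b` multiresolution (nested ANOVA) decomposition of `L²[0,1]^d`. -/
noncomputable def gainCoefficient (b : ℕ) {n d : ℕ} (a : Fin n → Fin d → ℝ)
    (u : Finset (Fin d)) (κ : Fin d → ℕ) : ℝ :=
  (1 / ((n : ℝ) * ((b : ℝ) - 1) ^ u.card)) *
    ∑ i : Fin n, ∑ i' : Fin n, ∏ j ∈ u,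
      ((b : ℝ) * (if ⌊(b : ℝ) ^ (κ j + 1) * a i j⌋ = ⌊(b : ℝ) ^ (κ j + 1) * a i' j⌋
          then 1 else 0) -
        (if ⌊(b : ℝ) ^ κ j * a i j⌋ = ⌊(b : ℝ) ^ κ j * a i' j⌋ then 1 else 0))

/-- All gain coefficients of all the nets of which a `(t, d)`-sequence in base `b` consists are
at most `Γ`. -/
def GainBoundedBy (b t d : ℕ) (a : ℕ → Fin d → ℝ) (Γ : ℝ) : Prop :=
  ∀ m, t ≤ m → ∀ r, ∀ u : Finset (Fin d), u.Nonempty → ∀ κ : Fin d → ℕ,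
    gainCoefficient b (block b m r a) u κ ≤ Γ

/-- The random permutations of a nested uniform scramble. There is one permutation of the digits
`{0, …, b-1}` for each coordinate `j` and each finite string of digits (the digits that precede
the one to be permuted); all of them are independent, and each one is uniformly distributed over
the `b !` permutations. -/
structure IsNestedUniformScramble {Ω : Type*} [MeasurableSpace Ω] (P : Measure Ω) (b d : ℕ)
    (π : Fin d × List (Fin b) → Ω → Equiv.Perm (Fin b)) : Prop where
  measurable : ∀ v, Measurable[_, ⊤] (π v)
  uniform : ∀ v (σ : Equiv.Perm (Fin b)), P (π v ⁻¹' {σ}) = ((b ! : ℕ) : ℝ≥0∞)⁻¹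
  indep : iIndepFun (m := fun _ => ⊤) π P

/-- Apply nested permutations to a point `a ∈ [0,1)^d`: if `a j` has the base `b` expansion
`0.a₀a₁a₂…`, then coordinate `j` of the result is `0.x₀x₁x₂…`, where `x_k` is the image of `a_k`
under the permutation that is attached to the coordinate `j` and the string `a₀ … a_{k-1}`. -/
noncomputable def scramblePoint (b : ℕ) [NeZero b] {d : ℕ}
    (π : Fin d × List (Fin b) → Equiv.Perm (Fin b)) (a : Fin d → ℝ) : Fin d → ℝ :=
  fun j => Real.ofDigits fun k : ℕ =>
    π (j, List.ofFn fun l : Fin k => Real.digits (a j) b l) (Real.digits (a j) b k)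

/-- The average of `f` over the first `n` points of the sequence `x`. -/
noncomputable def sampleMean {d : ℕ} (f : (Fin d → ℝ) → ℝ) (x : ℕ → Fin d → ℝ) (n : ℕ) : ℝ :=
  (∑ i ∈ Finset.range n, f (x i)) / n

end ScrambledNet

/-! Up to the factor Γ, a scrambled block of `n = b ^ m` points has the sampling variance of `n`
independent points. Given the original digits, the joint law of the first `K` digits of two
scrambled points is a product over coordinates of `1 + ∑ k, b ^ k / (b - 1) * (kernel of the
original digits) * (kernel of the new digits)` (`measureReal_scrambleDigits_pair`). Expanding the
product and summing over pairs of points, the kernels of the original digits become gain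
coefficients, and those of the new digits become nonnegative quadratic forms in the integrand. Each
gain may therefore be replaced by its bound Γ; with all gains equal to 1 the expansion collapses to
the diagonal, which is the integral of the square (`sum_pair_le`). Letting `K → ∞` for continuous
integrands and using density gives the variance bound on `L²` (`eLpNorm_sum_sub_le`).

For `f ∈ L^p` one may take `1 < p ≤ 2`. On a block of `n = b ^ m` points `f` is truncated at height
`n`. Both the variance of the truncated average and the probability that truncation alters a sampled
value are `O(n ^ (1 - p))`, which is summable over `m` because `n` grows geometrically. Hence the
averages over the `r`-th blocks converge almost surely for each `r` (`ae_tendsto_block_average`),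
and so do those over the first `R * b ^ m` points for each `R`. For `f ≥ 0` the partial sums are
monotone, and the sizes `R * b ^ m` with large `R` have consecutive ratios close to 1, so all sample
sizes follow (`tendsto_average_of_tendsto_block`). A general `f` is split into its positive and
negative parts. -/

open scoped BoundedContinuousFunction

namespace ScrambledNet

/-! ### Kernels on digit sequences and the quadratic form bound -/

/-- The indicator that two digit sequences agree in their first `k` digits. -/
def agree {b : ℕ} (k : ℕ) (s s' : ℕ → Fin b) : ℝ :=
  if ∀ l < k, s l = s' l then 1 else 0

/-- The centred indicator `b 1{s = s'} - 1` that two digits are equal. -/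
def digitKernel {b : ℕ} (x y : Fin b) : ℝ := (b : ℝ) * (if x = y then 1 else 0) - 1

/-- The kernel of level `k` of the base `b` multiresolution decomposition, up to a factor. -/
def levelKernel {b : ℕ} (k : ℕ) (s s' : ℕ → Fin b) : ℝ :=
  agree k s s' * digitKernel (s k) (s' k)

lemma agree_zero {b : ℕ} (s s' : ℕ → Fin b) : agree 0 s s' = 1 := by simp [agree]

lemma agree_self {b : ℕ} (k : ℕ) (s : ℕ → Fin b) : agree k s s = 1 := by simp [agree]

lemma agree_succ {b : ℕ} (k : ℕ) (s s' : ℕ → Fin b) :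
    agree (k + 1) s s' = agree k s s' * (if s k = s' k then 1 else 0) := by
  simp only [agree, Nat.forall_lt_succ_right]
  by_cases h1 : ∀ l < k, s l = s' l <;> by_cases h2 : s k = s' k <;> simp [h1, h2]

lemma levelKernel_eq {b : ℕ} (k : ℕ) (s s' : ℕ → Fin b) :
    levelKernel k s s' = b * agree (k + 1) s s' - agree k s s' := by
  rw [agree_succ, levelKernel, digitKernel]; ring

lemma one_add_sum_levelKernel {b : ℕ} (K : ℕ) (s s' : ℕ → Fin b) :
    1 + ∑ k ∈ Finset.range K, (b : ℝ) ^ k * levelKernel k s s' = b ^ K * agree K s s' := by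
  induction K with
  | zero => simp [agree_zero]
  | succ K ih => rw [Finset.sum_range_succ, ← add_assoc, ih, levelKernel_eq]; ring

lemma one_add_digitKernel {b : ℕ} (x y : Fin b) :
    1 + digitKernel x y = b * (if x = y then 1 else 0) := by
  rw [digitKernel]; ring

lemma digitKernel_self {b : ℕ} (x : Fin b) : digitKernel x x = b - 1 := by
  simp [digitKernel]

/-- While the original digits agree, the value `b - 1` of their kernel cancels the denominator and
each factor is `b` times the indicator that the new digits agree. -/
lemma prod_one_add_of_agree {b : ℕ} (hb : 2 ≤ b) (K : ℕ) {s s' : ℕ → Fin b}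
    (h : ∀ l < K, s l = s' l) (c c' : ℕ → Fin b) :
    ∏ k ∈ Finset.range K, (1 + agree k s s' * digitKernel (s k) (s' k) *
      digitKernel (c k) (c' k) / ((b : ℝ) - 1)) = b ^ K * agree K c c' := by
  have hb1 : (b : ℝ) - 1 ≠ 0 := by
    have : (2 : ℝ) ≤ b := by exact_mod_cast hb
    linarith
  induction K with
  | zero => simp [agree_zero]
  | succ K ih =>
    have h' : agree K s s' = 1 := if_pos fun l hl => h l (by omega)
    rw [Finset.prod_range_succ, ih fun l hl => h l (by omega), agree_succ, h K (by omega),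
      digitKernel_self, h', one_mul,
      mul_div_assoc, mul_div_cancel₀ _ hb1, one_add_digitKernel]
    ring

/-- The product telescopes. The increment at level `K` carries the factor `agree K s s'`; where that
is 1, the product so far is `b ^ K * agree K c c'`, which completes both digit kernels to level
kernels. -/
lemma prod_one_add_digitKernel {b : ℕ} (hb : 2 ≤ b) (K : ℕ) (s s' c c' : ℕ → Fin b) :
    ∏ k ∈ Finset.range K, (1 + agree k s s' * digitKernel (s k) (s' k) *
      digitKernel (c k) (c' k) / ((b : ℝ) - 1)) =
    1 + ∑ k ∈ Finset.range K,
      (b : ℝ) ^ k / ((b : ℝ) - 1) * (levelKernel k s s' * levelKernel k c c') := by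
  induction K with
  | zero => simp
  | succ K ih =>
    rw [Finset.prod_range_succ, Finset.sum_range_succ, ← add_assoc, ← ih]
    by_cases h : ∀ l < K, s l = s' l
    · rw [prod_one_add_of_agree hb K h, levelKernel, levelKernel]
      ring
    · simp [levelKernel, agree, h]

/-- The expansion of the `j`-th factor, indexed by `0` (the constant) and `k + 1` (level `k`). -/
def extKernel {b : ℕ} (o : ℕ) (s s' : ℕ → Fin b) : ℝ :=
  match o with
  | 0 => 1
  | k + 1 => levelKernel k s s'

/-- An instance of the Schur product theorem: the level kernel is a Gram kernel, so its features can
be absorbed into `g` one at a time. -/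
lemma sum_levelKernel_mul_self_nonneg {b : ℕ} {T : Type*} [Fintype T] (k : ℕ)
    (s : T → ℕ → Fin b) (M : T → T → ℝ)
    (hM : ∀ g : T → ℝ, 0 ≤ ∑ c, ∑ c', g c * g c' * M c c') (g : T → ℝ) :
    0 ≤ ∑ c, ∑ c', g c * g c' * (levelKernel k (s c) (s c') * M c c') := by
  classical
  rcases Nat.eq_zero_or_pos b with rfl | hb
  · have : IsEmpty T := ⟨fun c => (s c 0).elim0⟩
    simp
  have hb' : (0 : ℝ) < b := by exact_mod_cast hb
  -- One feature for each cell of the first `k` digits and each value of the next digit. The inner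
  -- products of the centred digit indicators are `b` times `digitKernel`, whence the factor `b⁻¹`
  -- below.
  let feat : (Fin k → Fin b) × Fin b → T → ℝ := fun v c =>
    (if (fun l : Fin k => s c l) = v.1 then 1 else 0) *
      ((b : ℝ) * (if s c k = v.2 then 1 else 0) - 1)
  have key : ∀ c c', levelKernel k (s c) (s c') = (b : ℝ)⁻¹ * ∑ v, feat v c * feat v c' := by
    intro c c'
    have h1 : ∑ v, feat v c * feat v c' =
        (∑ w : Fin k → Fin b, (if (fun l : Fin k => s c l) = w then (1 : ℝ) else 0) *
          (if (fun l : Fin k => s c' l) = w then 1 else 0)) *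
        ∑ w : Fin b, ((b : ℝ) * (if s c k = w then 1 else 0) - 1) *
          ((b : ℝ) * (if s c' k = w then 1 else 0) - 1) := by
      rw [Fintype.sum_prod_type, Finset.sum_mul_sum]
      refine Finset.sum_congr rfl fun _ _ => Finset.sum_congr rfl fun _ _ => ?_
      simp only [feat]; ring
    have h2 : (∑ w : Fin k → Fin b, (if (fun l : Fin k => s c l) = w then (1 : ℝ) else 0) *
          (if (fun l : Fin k => s c' l) = w then 1 else 0)) = agree k (s c) (s c') := by
      simp only [ite_mul, one_mul, zero_mul, Finset.sum_ite_eq, Finset.mem_univ, if_true, agree]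
      congr 1
      simp only [funext_iff, Fin.forall_iff, eq_iff_iff]
      exact ⟨fun h l hl => (h l hl).symm, fun h l hl => (h l hl).symm⟩
    have h3 : ∑ w : Fin b, ((b : ℝ) * (if s c k = w then 1 else 0) - 1) *
          ((b : ℝ) * (if s c' k = w then 1 else 0) - 1) =
        b * digitKernel (s c k) (s c' k) := by
      have : ∀ w : Fin b, ((b : ℝ) * (if s c k = w then 1 else 0) - 1) *
          ((b : ℝ) * (if s c' k = w then 1 else 0) - 1) =
          (if s c k = w then (b : ℝ) ^ 2 * (if s c' k = w then 1 else 0) else 0)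
          - (if s c k = w then (b : ℝ) else 0) - (if s c' k = w then (b : ℝ) else 0) + 1 := by
        intro w; split_ifs <;> ring
      simp only [this, Finset.sum_add_distrib, Finset.sum_sub_distrib, Finset.sum_ite_eq,
        Finset.mem_univ, if_true, digitKernel]
      simp [eq_comm (a := s c k)]
      split_ifs <;> ring
    rw [h1, h2, h3, levelKernel]
    field_simp
  have : ∑ c, ∑ c', g c * g c' * (levelKernel k (s c) (s c') * M c c') =
      (b : ℝ)⁻¹ * ∑ v, ∑ c, ∑ c', (g c * feat v c) * (g c' * feat v c') * M c c' := by
    simp_rw [key, Finset.mul_sum]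
    rw [Finset.sum_comm' (t' := Finset.univ) (s' := fun _ => Finset.univ) (by simp)]
    rw [Finset.sum_comm (s := (Finset.univ : Finset ((Fin k → Fin b) × Fin b)))]
    rw [Finset.sum_comm]
    refine Finset.sum_congr rfl fun c _ => ?_
    rw [Finset.sum_comm]
    refine Finset.sum_congr rfl fun c' _ => ?_
    rw [Finset.sum_mul, Finset.mul_sum]
    refine Finset.sum_congr rfl fun v _ => ?_
    ring
  rw [this]
  exact mul_nonneg (by positivity) (Finset.sum_nonneg fun v _ => hM _)

lemma sum_prod_extKernel_nonneg {b : ℕ} {T J : Type*} [Fintype T] (u : Finset J) (o : J → ℕ)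
    (s : T → J → ℕ → Fin b) (g : T → ℝ) :
    0 ≤ ∑ c, ∑ c', g c * g c' * ∏ j ∈ u, extKernel (o j) (s c j) (s c' j) := by
  classical
  induction u using Finset.induction_on generalizing g with
  | empty =>
    simp only [Finset.prod_empty, mul_one, ← Finset.sum_mul_sum]
    exact mul_self_nonneg _
  | insert j u hj ih =>
    simp only [Finset.prod_insert hj]
    rcases h : o j with _ | k
    · simpa [extKernel] using ih g
    · simp only [extKernel]
      exact sum_levelKernel_mul_self_nonneg k (fun c => s c j) _ ih g

/-- The weight of level `o` in the joint distribution of two scrambled points. -/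
noncomputable def levelWeight (b o : ℕ) : ℝ :=
  match o with
  | 0 => 1
  | k + 1 => (b : ℝ) ^ k / ((b : ℝ) - 1)

lemma one_add_sum_eq_sum_extKernel {b : ℕ} (K : ℕ) (s s' c c' : ℕ → Fin b) :
    1 + ∑ k ∈ Finset.range K,
      (b : ℝ) ^ k / ((b : ℝ) - 1) * (levelKernel k s s' * levelKernel k c c') =
    ∑ o ∈ Finset.range (K + 1), levelWeight b o * (extKernel o s s' * extKernel o c c') := by
  rw [Finset.sum_range_succ']
  simp [levelWeight, extKernel, add_comm]

/-- The dimension of level `o`: `1` for the constants, `b - 1` (per cell) for the others. -/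
noncomputable def levelDim (b o : ℕ) : ℝ := if o = 0 then 1 else (b : ℝ) - 1

/-- For level `k + 1`, weight times dimension is `b ^ k`, so the sum telescopes. This is the case of
gains equal to 1, where only the diagonal survives. -/
lemma sum_levelDim_mul_extKernel {b : ℕ} (hb : 2 ≤ b) (K : ℕ) (c c' : ℕ → Fin b) :
    ∑ o ∈ Finset.range (K + 1), levelWeight b o * levelDim b o * extKernel o c c' =
      b ^ K * agree K c c' := by
  have hb1 : (b : ℝ) - 1 ≠ 0 := by
    have : (2 : ℝ) ≤ b := by exact_mod_cast hb
    linarith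
  rw [Finset.sum_range_succ', ← one_add_sum_levelKernel, add_comm]
  simp [levelWeight, extKernel, levelDim, hb1]

/-- A bound for the gain coefficients bounds a quadratic form by the identity. -/
lemma sum_pair_le {b : ℕ} (hb : 2 ≤ b) {T I J : Type*} [Fintype T] [Fintype I] [Fintype J]
    (K : ℕ) (a : I → J → ℕ → Fin b) (c : T → J → ℕ → Fin b)
    (hc : ∀ v w, (∀ j, ∀ l < K, c v j l = c w j l) → v = w)
    (Γ : ℝ) (hΓ0 : 0 ≤ Γ)
    (hΓ : ∀ o : J → ℕ, o ≠ 0 → ∑ i, ∑ i', ∏ j, extKernel (o j) (a i j) (a i' j) ≤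
      Fintype.card I * (∏ j, levelDim b (o j)) * Γ) (g : T → ℝ) :
    ∑ i, ∑ i', ∑ v, ∑ w, g v * g w * ∏ j, (1 + ∑ k ∈ Finset.range K,
      (b : ℝ) ^ k / ((b : ℝ) - 1) *
        (levelKernel k (a i j) (a i' j) * levelKernel k (c v j) (c w j))) ≤
    (Fintype.card I) ^ 2 * (∑ v, g v) ^ 2 +
      Γ * Fintype.card I * (b : ℝ) ^ (K * Fintype.card J) * ∑ v, g v ^ 2 := by
  classical
  have hb1 : (0 : ℝ) < (b : ℝ) - 1 := by
    have : (2 : ℝ) ≤ b := by exact_mod_cast hb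
    linarith
  let S : Finset (J → ℕ) := Fintype.piFinset fun _ => Finset.range (K + 1)
  let W : (J → ℕ) → ℝ := fun o => ∏ j, levelWeight b (o j)
  let A : (J → ℕ) → ℝ := fun o => ∑ i, ∑ i', ∏ j, extKernel (o j) (a i j) (a i' j)
  let Q : (J → ℕ) → ℝ := fun o => ∑ v, ∑ w, g v * g w * ∏ j, extKernel (o j) (c v j) (c w j)
  have hW : ∀ o, 0 ≤ W o := fun o => Finset.prod_nonneg fun j _ => by
    rcases o j with _ | k <;> simp only [levelWeight] <;> positivity
  have hQ : ∀ o, 0 ≤ Q o := fun o => sum_prod_extKernel_nonneg _ o c g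
  have hD : ∀ o : J → ℕ, 0 ≤ ∏ j, levelDim b (o j) := fun o =>
    Finset.prod_nonneg fun j _ => by
      unfold levelDim; split_ifs <;> [exact zero_le_one; exact hb1.le]
  have h0S : (0 : J → ℕ) ∈ S := by simp [S]
  have expand : ∀ i i' v w, ∏ j, (1 + ∑ k ∈ Finset.range K,
      (b : ℝ) ^ k / ((b : ℝ) - 1) *
        (levelKernel k (a i j) (a i' j) * levelKernel k (c v j) (c w j))) =
      ∑ o ∈ S, W o * ((∏ j, extKernel (o j) (a i j) (a i' j)) *
        ∏ j, extKernel (o j) (c v j) (c w j)) := by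
    intro i i' v w
    simp_rw [one_add_sum_eq_sum_extKernel]
    rw [Finset.prod_univ_sum]
    simp [S, W, Finset.prod_mul_distrib]
  have lhs : ∑ i, ∑ i', ∑ v, ∑ w, g v * g w * ∏ j, (1 + ∑ k ∈ Finset.range K,
      (b : ℝ) ^ k / ((b : ℝ) - 1) *
        (levelKernel k (a i j) (a i' j) * levelKernel k (c v j) (c w j))) =
      ∑ o ∈ S, W o * (A o * Q o) := by
    have : ∀ o, W o * (A o * Q o) = ∑ i, ∑ i', ∑ v, ∑ w, g v * g w * (W o *
        ((∏ j, extKernel (o j) (a i j) (a i' j)) * ∏ j, extKernel (o j) (c v j) (c w j))) := by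
      intro o
      simp only [A, Q, Finset.sum_mul]
      simp only [Finset.mul_sum]
      refine Finset.sum_congr rfl fun _ _ => Finset.sum_congr rfl fun _ _ =>
        Finset.sum_congr rfl fun _ _ => Finset.sum_congr rfl fun _ _ => ?_
      ring
    simp_rw [this, expand, Finset.mul_sum]
    rw [Finset.sum_comm (s := S)]
    refine Finset.sum_congr rfl fun _ _ => ?_
    rw [Finset.sum_comm (s := S)]
    refine Finset.sum_congr rfl fun _ _ => ?_
    rw [Finset.sum_comm (s := S)]
    refine Finset.sum_congr rfl fun _ _ => ?_
    rw [Finset.sum_comm (s := S)]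
  -- Summing coordinate by coordinate gives a multiple of the indicator that the first `K` digits
  -- agree, which by `hc` is the identity matrix on `T`.
  have diag : ∑ o ∈ S, W o * (∏ j, levelDim b (o j)) * Q o =
      (b : ℝ) ^ (K * Fintype.card J) * ∑ v, g v ^ 2 := by
    have : ∀ o, W o * (∏ j, levelDim b (o j)) * Q o = ∑ v, ∑ w, g v * g w *
        ∏ j, (levelWeight b (o j) * levelDim b (o j) * extKernel (o j) (c v j) (c w j)) := by
      intro o
      simp only [Q, W, Finset.mul_sum, Finset.prod_mul_distrib]
      refine Finset.sum_congr rfl fun _ _ => Finset.sum_congr rfl fun _ _ => ?_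
      ring
    simp_rw [this]
    rw [Finset.sum_comm, Finset.mul_sum]
    refine Finset.sum_congr rfl fun v _ => ?_
    rw [Finset.sum_comm]
    simp_rw [← Finset.mul_sum]
    have h2 : ∀ w, ∑ o ∈ S, ∏ j,
        (levelWeight b (o j) * levelDim b (o j) * extKernel (o j) (c v j) (c w j)) =
        if v = w then (b : ℝ) ^ (K * Fintype.card J) else 0 := by
      intro w
      rw [← Finset.prod_univ_sum (fun _ => Finset.range (K + 1))
        (fun j o => levelWeight b o * levelDim b o * extKernel o (c v j) (c w j))]
      simp_rw [sum_levelDim_mul_extKernel hb]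
      split_ifs with h
      · subst h
        simp [agree_self, pow_mul]
      · obtain ⟨j, hj⟩ : ∃ j, ¬ ∀ l < K, c v j l = c w j l := by
          by_contra! hcon
          exact h (hc v w hcon)
        exact Finset.prod_eq_zero (Finset.mem_univ j) (by simp [agree, hj])
    simp_rw [h2]
    simp
    ring
  -- The constant term is the squared mean; it has no gain coefficient and is kept exactly.
  have zero : W 0 * (A 0 * Q 0) = (Fintype.card I) ^ 2 * (∑ v, g v) ^ 2 := by
    simp only [W, A, Q, levelWeight, extKernel, Finset.prod_const_one, mul_one,
      ← Finset.sum_mul_sum, one_mul, sq]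
    simp
  rw [lhs, ← Finset.add_sum_erase _ _ h0S, zero]
  gcongr
  calc ∑ o ∈ S.erase 0, W o * (A o * Q o)
      ≤ ∑ o ∈ S.erase 0, (Γ * Fintype.card I) * (W o * (∏ j, levelDim b (o j)) * Q o) := by
        refine Finset.sum_le_sum fun o ho => ?_
        have := mul_le_mul_of_nonneg_left (hΓ o (Finset.ne_of_mem_erase ho))
          (mul_nonneg (hW o) (hQ o))
        calc _ = W o * Q o * A o := by ring
          _ ≤ _ := this
          _ = _ := by ring
    -- The term `o = 0` is restored, at no cost since it is nonnegative, so that the full sum `diag`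
    -- applies.
    _ ≤ ∑ o ∈ S, (Γ * Fintype.card I) * (W o * (∏ j, levelDim b (o j)) * Q o) :=
        Finset.sum_le_sum_of_subset_of_nonneg (Finset.erase_subset _ _) fun o _ _ =>
          mul_nonneg (by positivity) (mul_nonneg (mul_nonneg (hW o) (hD o)) (hQ o))
    _ = _ := by rw [← Finset.mul_sum, diag]; ring

/-! ### Joint law of the digits of two scrambled points -/

lemma card_perm_apply_eq {α : Type*} [Fintype α] [DecidableEq α] (x y : α) :
    (Finset.univ.filter fun σ : Equiv.Perm α => σ x = y).card * Fintype.card α =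
      (Fintype.card α)! := by
  have h1 : ∀ z, (Finset.univ.filter fun σ : Equiv.Perm α => σ x = z).card =
      (Finset.univ.filter fun σ : Equiv.Perm α => σ x = y).card := fun z =>
    Finset.card_equiv (Equiv.mulLeft (Equiv.swap z y)) fun σ => by
      simp [Equiv.swap_apply_eq_iff]
  have h2 := Finset.card_eq_sum_card_fiberwise (s := (Finset.univ : Finset (Equiv.Perm α)))
    (t := Finset.univ) (f := fun σ => σ x) (by simp [Set.MapsTo])
  simp only [h1, Finset.sum_const, Finset.card_univ, Fintype.card_perm, smul_eq_mul] at h2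
  rw [h2, mul_comm]

lemma card_perm_apply_eq_and {α : Type*} [Fintype α] [DecidableEq α] {x y x' y' : α}
    (hx : x ≠ x') (hy : y ≠ y') :
    (Finset.univ.filter fun σ : Equiv.Perm α => σ x = y ∧ σ x' = y').card *
      (Fintype.card α - 1) = (Finset.univ.filter fun σ : Equiv.Perm α => σ x = y).card := by
  have h1 : ∀ z ∈ Finset.univ.erase y,
      ((Finset.univ.filter fun σ : Equiv.Perm α => σ x = y).filter fun σ => σ x' = z).card =
      (Finset.univ.filter fun σ : Equiv.Perm α => σ x = y ∧ σ x' = y').card := by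
    intro z hz
    have hz : z ≠ y := Finset.ne_of_mem_erase hz
    -- This transposition fixes `y`, so it preserves the condition `σ x = y` while exchanging the
    -- possible values of `σ x'`.
    refine Finset.card_equiv (Equiv.mulLeft (Equiv.swap z y')) fun σ => ?_
    simp [Equiv.swap_apply_eq_iff, Equiv.swap_apply_of_ne_of_ne hz.symm hy]
  have h2 := Finset.card_eq_sum_card_fiberwise
    (s := Finset.univ.filter fun σ : Equiv.Perm α => σ x = y)
    (t := Finset.univ.erase y) (f := fun σ => σ x') (fun σ hσ => by
      simp only [Finset.coe_filter, Finset.mem_univ, true_and, Set.mem_ofPred_eq] at hσ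
      simp only [Finset.coe_erase, Finset.coe_univ, Set.mem_sdiff, Set.mem_univ, true_and,
        Set.mem_singleton_iff]
      intro h
      exact hx (σ.injective (hσ.trans h.symm)))
  rw [Finset.sum_congr rfl h1] at h2
  simp only [Finset.sum_const, Finset.card_erase_of_mem (Finset.mem_univ y), Finset.card_univ,
    smul_eq_mul] at h2
  rw [h2, mul_comm]

section

variable {Ω : Type*} [MeasurableSpace Ω] {P : Measure Ω} [IsProbabilityMeasure P]

lemma measureReal_uniform_mem {b : ℕ} {X : Ω → Equiv.Perm (Fin b)} (hX : Measurable[_, ⊤] X)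
    (hu : ∀ σ, P (X ⁻¹' {σ}) = ((b ! : ℕ) : ℝ≥0∞)⁻¹) (Q : Equiv.Perm (Fin b) → Prop)
    [DecidablePred Q] :
    P.real {ω | Q (X ω)} = (Finset.univ.filter Q).card / (b ! : ℝ) := by
  let : MeasurableSpace (Equiv.Perm (Fin b)) := ⊤
  have h : {ω | Q (X ω)} = ⋃ σ ∈ Finset.univ.filter Q, X ⁻¹' {σ} := by
    ext ω; simp
  rw [h, measureReal_biUnion_finset]
  · simp [Measure.real, hu, div_eq_mul_inv]
  · intro σ _ τ _ hne
    refine Set.disjoint_left.2 fun ω h1 h2 => hne ?_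
    simp only [Set.mem_preimage, Set.mem_singleton_iff] at h1 h2
    rw [← h1, h2]
  · exact fun σ _ => hX trivial

lemma measureReal_uniform_apply {b : ℕ} (hb : 2 ≤ b) {X : Ω → Equiv.Perm (Fin b)}
    (hX : Measurable[_, ⊤] X) (hu : ∀ σ, P (X ⁻¹' {σ}) = ((b ! : ℕ) : ℝ≥0∞)⁻¹) (x y : Fin b) :
    P.real {ω | X ω x = y} = (b : ℝ)⁻¹ := by
  rw [measureReal_uniform_mem hX hu fun σ => σ x = y]
  have h := card_perm_apply_eq x y
  rw [Fintype.card_fin] at h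
  have h' : ((Finset.univ.filter fun σ : Equiv.Perm (Fin b) => σ x = y).card : ℝ) * b = b ! := by
    exact_mod_cast h
  have : (b : ℝ) ≠ 0 := by positivity
  have : (b ! : ℝ) ≠ 0 := by positivity
  field_simp
  linarith

/-- One formula covers all cases: `1 / b` when both pairs are equal, `0` when exactly one is, and `1
/ (b (b - 1))` when neither is. -/
lemma measureReal_uniform_pair {b : ℕ} (hb : 2 ≤ b) {X : Ω → Equiv.Perm (Fin b)}
    (hX : Measurable[_, ⊤] X) (hu : ∀ σ, P (X ⁻¹' {σ}) = ((b ! : ℕ) : ℝ≥0∞)⁻¹)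
    (x y x' y' : Fin b) :
    P.real {ω | X ω x = y ∧ X ω x' = y'} =
      ((b : ℝ) ^ 2)⁻¹ * (1 + digitKernel x x' * digitKernel y y' / ((b : ℝ) - 1)) := by
  have hb2 : (2 : ℝ) ≤ b := by exact_mod_cast hb
  have hb1 : (b : ℝ) - 1 ≠ 0 := by linarith
  have hb0 : (b : ℝ) ≠ 0 := by linarith
  by_cases hx : x = x' <;> by_cases hy : y = y'
  · subst hx hy
    simp only [and_self, digitKernel_self]
    rw [measureReal_uniform_apply hb hX hu]
    field_simp
    ring
  · subst hx
    have : {ω | X ω x = y ∧ X ω x = y'} = ∅ := by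
      ext ω; simp; rintro rfl; exact hy
    rw [this, digitKernel_self, measureReal_empty]
    simp only [digitKernel, hy, if_false]
    field_simp
    ring
  · subst hy
    have : {ω | X ω x = y ∧ X ω x' = y} = ∅ := by
      ext ω; simp; rintro rfl; exact fun h => hx ((X ω).injective h).symm
    rw [this, digitKernel_self, measureReal_empty]
    simp only [digitKernel, hx, if_false]
    field_simp
    ring
  · have h1 := measureReal_uniform_apply hb hX hu x y
    rw [measureReal_uniform_mem hX hu fun σ => σ x = y, ← card_perm_apply_eq_and hx hy,
      Fintype.card_fin] at h1
    rw [measureReal_uniform_mem hX hu fun σ => σ x = y ∧ σ x' = y']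
    push_cast [Nat.cast_sub (show 1 ≤ b by omega)] at h1
    have hf : (b ! : ℝ) ≠ 0 := by positivity
    simp only [digitKernel, hx, hy, if_false]
    field_simp at h1 ⊢
    linear_combination (b : ℝ) * h1

/-- The indices `v e` and `v' e` may coincide, so independence is used between the groups `{v e, v'
e}`, which are disjoint for different `e`. -/
lemma measureReal_forall_pair {V S ε : Type*} [Fintype S] [DecidableEq V] {π : V → Ω → S}
    (hm : ∀ v, Measurable[_, ⊤] (π v)) (hi : iIndepFun (m := fun _ => ⊤) π P) (E : Finset ε)
    (v v' : ε → V)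
    (hv : ∀ e e', e ≠ e' → v e ≠ v e' ∧ v e ≠ v' e' ∧ v' e ≠ v' e')
    (Q : ε → S → S → Prop) :
    P.real {ω | ∀ e ∈ E, Q e (π (v e) ω) (π (v' e) ω)} =
      ∏ e ∈ E, P.real {ω | Q e (π (v e) ω) (π (v' e) ω)} := by
  classical
  let : MeasurableSpace S := ⊤
  have : DiscreteMeasurableSpace S := ⟨fun _ => trivial⟩
  induction E using Finset.induction_on with
  | empty => simp
  | insert e E he ih =>
    rw [Finset.prod_insert he, ← ih]
    let S₁ : Finset V := {v e, v' e}
    let S₂ : Finset V := E.biUnion fun e => {v e, v' e}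
    have hd : Disjoint S₁ S₂ := by
      rw [Finset.disjoint_left]
      intro w hw hw'
      simp only [S₂, Finset.mem_biUnion, Finset.mem_insert, Finset.mem_singleton] at hw'
      obtain ⟨e', he', h'⟩ := hw'
      have hne : e ≠ e' := fun h => he (h ▸ he')
      have a1 := hv e e' hne
      have a2 := hv e' e hne.symm
      simp only [S₁, Finset.mem_insert, Finset.mem_singleton] at hw
      rcases hw with rfl | rfl <;> rcases h' with h' | h'
      · exact a1.1 h'
      · exact a1.2.1 h'
      · exact a2.2.1 h'.symm
      · exact a1.2.2 h'
    have hind := hi.indepFun_finset S₁ S₂ hd hm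
    have m1 : ∀ e' ∈ E, v e' ∈ S₂ := fun e' h => Finset.mem_biUnion.2 ⟨e', h, by simp⟩
    have m2 : ∀ e' ∈ E, v' e' ∈ S₂ := fun e' h => Finset.mem_biUnion.2 ⟨e', h, by simp⟩
    let A : Set (S₁ → S) := {h | Q e (h ⟨v e, by simp [S₁]⟩) (h ⟨v' e, by simp [S₁]⟩)}
    let B : Set (S₂ → S) :=
      {h | ∀ e' (he' : e' ∈ E), Q e' (h ⟨v e', m1 e' he'⟩) (h ⟨v' e', m2 e' he'⟩)}
    have key := hind.measure_inter_preimage_eq_mul A B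
      (Set.toFinite A).measurableSet (Set.toFinite B).measurableSet
    have : {ω | ∀ e' ∈ insert e E, Q e' (π (v e') ω) (π (v' e') ω)} =
        (fun ω (i : S₁) => π i ω) ⁻¹' A ∩ (fun ω (i : S₂) => π i ω) ⁻¹' B := by
      ext ω
      simp [A, B]
    rw [this, Measure.real, key, ENNReal.toReal_mul]
    rfl

/-- The digits of a point after the nested scramble of its digits. -/
def scrambleDigits {b d : ℕ} (σ : Fin d × List (Fin b) → Equiv.Perm (Fin b))
    (s : Fin d → ℕ → Fin b) : Fin d → ℕ → Fin b :=
  fun j k => σ (j, List.ofFn fun l : Fin k => s j l) (s j k)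

lemma measurable_scrambleDigits {b d : ℕ} {π : Fin d × List (Fin b) → Ω → Equiv.Perm (Fin b)}
    (hm : ∀ v, Measurable[_, ⊤] (π v)) (s : Fin d → ℕ → Fin b) :
    Measurable fun ω => scrambleDigits (fun v => π v ω) s := by
  let : MeasurableSpace (Equiv.Perm (Fin b)) := ⊤
  refine measurable_pi_lambda _ fun j => measurable_pi_lambda _ fun k => ?_
  exact (measurable_from_top (f := fun σ : Equiv.Perm (Fin b) => σ (s j k))).comp (hm _)

lemma ofFn_eq_iff {b : ℕ} {s s' : ℕ → Fin b} {k : ℕ} :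
    (List.ofFn (fun l : Fin k => s l) = List.ofFn fun l : Fin k => s' l) ↔
      ∀ l < k, s l = s' l := by
  rw [List.ofFn_inj, funext_iff, Fin.forall_iff]

/-- The joint distribution of the first `K` digits of two scrambled points. -/
lemma measureReal_scrambleDigits_pair {b d : ℕ} (hb : 2 ≤ b)
    {π : Fin d × List (Fin b) → Ω → Equiv.Perm (Fin b)} (hπ : IsNestedUniformScramble P b d π)
    (K : ℕ) (s s' c c' : Fin d → ℕ → Fin b) :
    P.real {ω | ∀ j, ∀ k < K, scrambleDigits (fun v => π v ω) s j k = c j k ∧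
        scrambleDigits (fun v => π v ω) s' j k = c' j k} =
      ((b : ℝ) ^ (2 * K * d))⁻¹ * ∏ j, (1 + ∑ k ∈ Finset.range K,
        (b : ℝ) ^ k / ((b : ℝ) - 1) *
          (levelKernel k (s j) (s' j) * levelKernel k (c j) (c' j))) := by
  classical
  have h := measureReal_forall_pair hπ.measurable hπ.indep
    ((Finset.univ : Finset (Fin d)) ×ˢ Finset.range K)
    (fun e => (e.1, List.ofFn fun l : Fin e.2 => s e.1 l))
    (fun e => (e.1, List.ofFn fun l : Fin e.2 => s' e.1 l)) (by
      -- The length of the string recovers `k`, so different digit positions never use the same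
      -- permutation.
      rintro ⟨j, k⟩ ⟨j', k'⟩ hne
      have : ∀ (r r' : Fin d → ℕ → Fin b), (j, List.ofFn fun l : Fin k => r j l) ≠
          (j', List.ofFn fun l : Fin k' => r' j' l) := by
        intro r r' heq
        rw [Prod.mk.injEq] at heq
        have h2 := congrArg List.length heq.2
        simp only [List.length_ofFn] at h2
        exact hne (by rw [heq.1, h2])
      exact ⟨this _ _, this _ _, this _ _⟩)
    (fun e σ σ' => σ (s e.1 e.2) = c e.1 e.2 ∧ σ' (s' e.1 e.2) = c' e.1 e.2)
  have hset : {ω | ∀ j, ∀ k < K, scrambleDigits (fun v => π v ω) s j k = c j k ∧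
        scrambleDigits (fun v => π v ω) s' j k = c' j k} =
      {ω | ∀ e ∈ (Finset.univ : Finset (Fin d)) ×ˢ Finset.range K,
        π (e.1, List.ofFn fun l : Fin e.2 => s e.1 l) ω (s e.1 e.2) = c e.1 e.2 ∧
        π (e.1, List.ofFn fun l : Fin e.2 => s' e.1 l) ω (s' e.1 e.2) = c' e.1 e.2} := by
    ext ω
    simp [scrambleDigits]
  rw [hset, h, Finset.prod_product]
  have hK : ((b : ℝ) ^ (2 * K * d))⁻¹ = ∏ j : Fin d, ((b : ℝ) ^ (2 * K))⁻¹ := by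
    simp [pow_mul]
  rw [hK, ← Finset.prod_mul_distrib]
  refine Finset.prod_congr rfl fun j _ => ?_
  rw [← prod_one_add_digitKernel hb]
  have hK' : ((b : ℝ) ^ (2 * K))⁻¹ = ∏ k ∈ Finset.range K, ((b : ℝ) ^ 2)⁻¹ := by
    simp [pow_mul]
  rw [hK', ← Finset.prod_mul_distrib]
  refine Finset.prod_congr rfl fun k _ => ?_
  -- As long as the prefixes agree, both digits pass through one common permutation; otherwise
  -- through two independent ones, and the factor is just `b⁻²`.
  by_cases hs : ∀ l < k, s j l = s' j l
  · have := ofFn_eq_iff.2 hs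
    simp only [this]
    rw [measureReal_uniform_pair hb (hπ.measurable _) (hπ.uniform _)]
    rw [agree, if_pos hs, one_mul]
  · have hne : (j, List.ofFn fun l : Fin k => s j l) ≠ (j, List.ofFn fun l : Fin k => s' j l) :=
      fun h => hs (ofFn_eq_iff.1 (Prod.mk.inj h).2)
    have hind := hπ.indep.indepFun hne
    have := hind.measure_inter_preimage_eq_mul {σ | σ (s j k) = c j k}
      {σ | σ (s' j k) = c' j k} trivial trivial
    have h2 : {ω | π (j, List.ofFn fun l : Fin k => s j l) ω (s j k) = c j k ∧
        π (j, List.ofFn fun l : Fin k => s' j l) ω (s' j k) = c' j k} =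
        π (j, List.ofFn fun l : Fin k => s j l) ⁻¹' {σ | σ (s j k) = c j k} ∩
        π (j, List.ofFn fun l : Fin k => s' j l) ⁻¹' {σ | σ (s' j k) = c' j k} := rfl
    simp only [agree, hs, if_false]
    rw [h2, Measure.real, this, ENNReal.toReal_mul]
    change P.real {ω | π (j, List.ofFn fun l : Fin k => s j l) ω (s j k) = c j k} *
      P.real {ω | π (j, List.ofFn fun l : Fin k => s' j l) ω (s' j k) = c' j k} = _
    rw [measureReal_uniform_apply hb (hπ.measurable _) (hπ.uniform _),
      measureReal_uniform_apply hb (hπ.measurable _) (hπ.uniform _)]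
    ring

/-- Every string of first digits of a scrambled point is equally likely. -/
lemma measureReal_scrambleDigits {b d : ℕ} (hb : 2 ≤ b)
    {π : Fin d × List (Fin b) → Ω → Equiv.Perm (Fin b)} (hπ : IsNestedUniformScramble P b d π)
    (K : ℕ) (s c : Fin d → ℕ → Fin b) :
    P.real {ω | ∀ j, ∀ k < K, scrambleDigits (fun v => π v ω) s j k = c j k} =
      ((b : ℝ) ^ (K * d))⁻¹ := by
  have hb2 : (2 : ℝ) ≤ b := by exact_mod_cast hb
  have hb1 : (b : ℝ) - 1 ≠ 0 := by linarith
  -- The marginal law is read off from the joint law of a point with itself.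
  have h := measureReal_scrambleDigits_pair hb hπ K s s c c
  simp only [and_self] at h
  have : ∀ j, 1 + ∑ k ∈ Finset.range K, (b : ℝ) ^ k / ((b : ℝ) - 1) *
          (levelKernel k (s j) (s j) * levelKernel k (c j) (c j)) = b ^ K := by
    intro j
    have h1 := one_add_sum_levelKernel K (c j) (c j)
    rw [agree_self, mul_one] at h1
    rw [← h1]
    congr 1
    refine Finset.sum_congr rfl fun k _ => ?_
    simp only [levelKernel, agree_self, digitKernel_self]
    field_simp
  simp only [this, Finset.prod_const, Finset.card_univ, Fintype.card_fin] at h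
  rw [h, ← pow_mul, show 2 * K * d = K * d + K * d by ring, pow_add, mul_inv]
  field_simp

end

/-! ### Gain coefficients in terms of digits -/

lemma floor_pow_mul_eq_iff {b : ℕ} [NeZero b] {x y : ℝ} (hx : x ∈ Set.Ico (0 : ℝ) 1)
    (hy : y ∈ Set.Ico (0 : ℝ) 1) (k : ℕ) :
    ⌊(b : ℝ) ^ k * x⌋ = ⌊(b : ℝ) ^ k * y⌋ ↔
      ∀ l < k, Real.digits x b l = Real.digits y b l := by
  have hb : (b : ℝ) ≠ 0 := by exact_mod_cast NeZero.ne b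
  rw [← Int.natCast_floor_eq_floor (mul_nonneg (by positivity) hx.1),
    ← Int.natCast_floor_eq_floor (mul_nonneg (by positivity) hy.1), Nat.cast_inj]
  constructor
  · intro h l hl
    have key : ∀ z : ℝ, ⌊z * (b : ℝ) ^ (l + 1)⌋₊ = ⌊(b : ℝ) ^ k * z⌋₊ / b ^ (k - (l + 1)) := by
      intro z
      rw [← Nat.floor_div_natCast]
      congr 1
      push_cast
      rw [eq_div_iff (by positivity), mul_assoc, ← pow_add, mul_comm,
        Nat.add_sub_cancel' (by omega)]
    simp only [Real.digits, key, h]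
  · intro h
    have h1 := Real.ofDigits_digits_sum_eq (b := b) hx k
    have h2 := Real.ofDigits_digits_sum_eq (b := b) hy k
    have h3 : ∑ i ∈ Finset.range k, Real.ofDigitsTerm (Real.digits x b) i =
        ∑ i ∈ Finset.range k, Real.ofDigitsTerm (Real.digits y b) i :=
      Finset.sum_congr rfl fun i hi => by
        simp only [Real.ofDigitsTerm, h i (Finset.mem_range.1 hi)]
    rw [h3, h2] at h1
    exact_mod_cast h1.symm

/-- A bound for the gain coefficients, in terms of the digits of the points. -/
lemma sum_prod_extKernel_le {b n d : ℕ} [NeZero b] (hb : 2 ≤ b) (hn : 0 < n)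
    {a : Fin n → Fin d → ℝ} (ha : ∀ i j, a i j ∈ Set.Ico (0 : ℝ) 1) {Γ : ℝ}
    (hΓ : ∀ u : Finset (Fin d), u.Nonempty → ∀ κ : Fin d → ℕ, gainCoefficient b a u κ ≤ Γ)
    {o : Fin d → ℕ} (ho : o ≠ 0) :
    ∑ i, ∑ i', ∏ j, extKernel (o j) (Real.digits (a i j) b) (Real.digits (a i' j) b) ≤
      n * (∏ j, levelDim b (o j)) * Γ := by
  classical
  have hb1 : (0 : ℝ) < (b : ℝ) - 1 := by
    have : (2 : ℝ) ≤ b := by exact_mod_cast hb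
    linarith
  have hn' : (0 : ℝ) < n := by exact_mod_cast hn
  -- The support of `o` plays the role of `u`, and `κ j = o j - 1` because level `0` is reserved for
  -- the constants.
  let u : Finset (Fin d) := Finset.univ.filter fun j => o j ≠ 0
  have hu : u.Nonempty := by
    obtain ⟨j, hj⟩ := Function.ne_iff.1 ho
    exact ⟨j, by simpa [u] using hj⟩
  have hdim : ∏ j, levelDim b (o j) = ((b : ℝ) - 1) ^ u.card := by
    rw [← Finset.prod_const, Finset.prod_filter]
    refine Finset.prod_congr rfl fun j _ => ?_
    by_cases h : o j = 0 <;> simp [levelDim, h]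
  have hprod : ∀ i i', ∏ j, extKernel (o j) (Real.digits (a i j) b) (Real.digits (a i' j) b) =
      ∏ j ∈ u, ((b : ℝ) * (if ⌊(b : ℝ) ^ ((o j - 1) + 1) * a i j⌋ =
          ⌊(b : ℝ) ^ ((o j - 1) + 1) * a i' j⌋ then 1 else 0) -
        (if ⌊(b : ℝ) ^ (o j - 1) * a i j⌋ = ⌊(b : ℝ) ^ (o j - 1) * a i' j⌋ then 1 else 0)) := by
    intro i i'
    rw [Finset.prod_filter]
    refine Finset.prod_congr rfl fun j _ => ?_
    rcases h : o j with _ | k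
    · simp [extKernel]
    · simp only [extKernel, ne_eq, Nat.add_eq_zero_iff, one_ne_zero, and_false,
        not_false_eq_true, if_true, Nat.add_sub_cancel, levelKernel_eq, agree,
        floor_pow_mul_eq_iff (ha i j) (ha i' j)]
  have h := hΓ u hu fun j => o j - 1
  rw [gainCoefficient, one_div, inv_mul_le_iff₀ (by positivity)] at h
  rw [hdim]
  simp_rw [hprod]
  convert h using 6

/-! ### Digits and the uniform distribution on the cube -/

/-- The first `K` digits. -/
def firstDigits {b d : ℕ} (K : ℕ) (s : Fin d → ℕ → Fin b) : Fin d → Fin K → Fin b :=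
  fun j k => s j k

/-- Extend strings of digits by zeros. -/
def padDigits {b d K : ℕ} [NeZero b] (c : Fin d → Fin K → Fin b) : Fin d → ℕ → Fin b :=
  fun j k => if h : k < K then c j ⟨k, h⟩ else 0

/-- The point with the given digits. -/
noncomputable def pointOfDigits {b d : ℕ} (s : Fin d → ℕ → Fin b) : Fin d → ℝ :=
  fun j => Real.ofDigits (s j)

/-- The digits of a point. -/
noncomputable def pointDigits (b : ℕ) [NeZero b] {d : ℕ} (x : Fin d → ℝ) : Fin d → ℕ → Fin b :=
  fun j => Real.digits (x j) b

lemma firstDigits_eq_iff {b d K : ℕ} [NeZero b] {s : Fin d → ℕ → Fin b}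
    {c : Fin d → Fin K → Fin b} :
    firstDigits K s = c ↔ ∀ j, ∀ k < K, s j k = padDigits c j k := by
  constructor
  · rintro rfl j k hk
    simp [firstDigits, padDigits, hk]
  · intro h
    ext j k : 2
    simpa [padDigits, firstDigits] using h j k k.2

lemma continuous_pointOfDigits {b d : ℕ} :
    Continuous (pointOfDigits : (Fin d → ℕ → Fin b) → Fin d → ℝ) :=
  continuous_pi fun j => Real.continuous_ofDigits.comp (continuous_apply j)

lemma tendsto_pointOfDigits_firstDigits {b d : ℕ} [NeZero b] (s : Fin d → ℕ → Fin b) :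
    Tendsto (fun K => pointOfDigits (padDigits (firstDigits K s))) atTop
      (𝓝 (pointOfDigits s)) := by
  refine (continuous_pointOfDigits.tendsto s).comp ?_
  refine tendsto_pi_nhds.2 fun j => tendsto_pi_nhds.2 fun k => ?_
  refine tendsto_const_nhds.congr' ?_
  filter_upwards [eventually_gt_atTop k] with K hK
  simp [padDigits, firstDigits, hK]

lemma measurable_digits (b : ℕ) [NeZero b] (k : ℕ) :
    Measurable fun x : ℝ => Real.digits x b k := by
  unfold Real.digits
  exact (measurable_from_top (f := fun m : ℕ => Fin.ofNat b m)).comp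
    (Nat.measurable_floor.comp (measurable_id.mul_const _))

lemma measurable_pointDigits (b d : ℕ) [NeZero b] :
    Measurable (pointDigits b : (Fin d → ℝ) → _) :=
  measurable_pi_lambda _ fun j => measurable_pi_lambda _ fun k =>
    (measurable_digits b k).comp (measurable_pi_apply j)

lemma measurable_firstDigits {b d : ℕ} (K : ℕ) :
    Measurable (firstDigits K : (Fin d → ℕ → Fin b) → _) :=
  measurable_pi_lambda _ fun j => measurable_pi_lambda _ fun k =>
    (measurable_pi_apply (k : ℕ)).comp (measurable_pi_apply j)

lemma pointOfDigits_pointDigits {b d : ℕ} [NeZero b] (hb : 2 ≤ b) {x : Fin d → ℝ}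
    (hx : x ∈ Set.univ.pi fun _ => Set.Ico (0 : ℝ) 1) :
    pointOfDigits (pointDigits b x) = x :=
  funext fun j => Real.ofDigits_digits (by omega) (hx j trivial)

/-- The uniform distribution on the unit cube. -/
noncomputable def cubeMeasure (d : ℕ) : Measure (Fin d → ℝ) :=
  volume.restrict (Set.Icc (0 : Fin d → ℝ) 1)

lemma cubeMeasure_eq (d : ℕ) :
    cubeMeasure d = volume.restrict (Set.univ.pi fun _ => Set.Ico (0 : ℝ) 1) :=
  Measure.restrict_congr_set
    (Measure.univ_pi_Ico_ae_eq_Icc (f := (0 : Fin d → ℝ)) (g := 1)).symm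

instance (d : ℕ) : IsProbabilityMeasure (cubeMeasure d) :=
  ⟨by simp [cubeMeasure, Real.volume_Icc_pi]⟩

lemma ae_cubeMeasure_mem (d : ℕ) :
    ∀ᵐ x ∂(cubeMeasure d), x ∈ Set.univ.pi fun _ => Set.Ico (0 : ℝ) 1 := by
  rw [cubeMeasure_eq]
  exact ae_restrict_mem (MeasurableSet.univ_pi fun _ => measurableSet_Ico)

lemma cubeMeasure_digits_le {b d : ℕ} [NeZero b] (hb : 2 ≤ b) (K : ℕ)
    (c : Fin d → Fin K → Fin b) :
    (cubeMeasure d).real ((fun x => firstDigits K (pointDigits b x)) ⁻¹' {c}) ≤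
      ((b : ℝ) ^ (K * d))⁻¹ := by
  have hb0 : (b : ℝ) ≠ 0 := by positivity
  let v : Fin d → ℝ := fun j => ∑ i ∈ Finset.range K, Real.ofDigitsTerm (padDigits c j) i
  have hsub : ((fun x => firstDigits K (pointDigits b x)) ⁻¹' {c}) ∩
      (Set.univ.pi fun _ => Set.Ico (0 : ℝ) 1) ⊆
      Set.Icc v (fun j => v j + ((b : ℝ) ^ K)⁻¹) := by
    rintro x ⟨h1, h2⟩
    have h1 := firstDigits_eq_iff.1 h1
    have key : ∀ j, v j ≤ x j ∧ x j ≤ v j + ((b : ℝ) ^ K)⁻¹ := by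
      intro j
      have hs : v j = ∑ i ∈ Finset.range K, Real.ofDigitsTerm (Real.digits (x j) b) i :=
        Finset.sum_congr rfl fun i hi => by
          have := h1 j i (Finset.mem_range.1 hi)
          simp only [pointDigits] at this
          simp only [Real.ofDigitsTerm, this]
      have h3 := Real.sum_ofDigitsTerm_digits_le (b := b) (h2 j trivial) K
      have h4 := Real.le_sum_ofDigitsTerm_digits (b := b) (h2 j trivial) K
      rw [← hs] at h3 h4
      rw [inv_pow] at h4
      exact ⟨h3, by linarith⟩
    exact ⟨fun j => (key j).1, fun j => (key j).2⟩
  rw [cubeMeasure_eq, measureReal_restrict_apply']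
  · refine (measureReal_mono hsub ?_).trans_eq ?_
    · simp [Real.volume_Icc_pi]
    · simp [Measure.real, Real.volume_Icc_pi, pow_mul]
  · exact MeasurableSet.univ_pi fun _ => measurableSet_Ico

lemma sum_measureReal_preimage_singleton {X T : Type*} [MeasurableSpace X] [Fintype T]
    [MeasurableSpace T] [MeasurableSingletonClass T] (μ : Measure X) [IsProbabilityMeasure μ]
    {R : X → T} (hR : Measurable R) : ∑ c, μ.real (R ⁻¹' {c}) = 1 := by
  have h := measureReal_biUnion_finset (μ := μ) (s := (Finset.univ : Finset T))
    (f := fun c => R ⁻¹' {c}) (fun c _ c' _ hne => Set.disjoint_left.2 fun x h1 h2 => by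
      simp only [Set.mem_preimage, Set.mem_singleton_iff] at h1 h2
      exact hne (h1.symm.trans h2)) (fun c _ => hR (measurableSet_singleton c))
  rw [← h]
  have : (⋃ c ∈ (Finset.univ : Finset T), R ⁻¹' {c}) = Set.univ := by ext; simp
  rw [this, probReal_univ]

/-- There are `b ^ (K * d)` cells of total mass 1, so the upper bound for each of them must be an
equality. -/
lemma cubeMeasure_digits {b d : ℕ} [NeZero b] (hb : 2 ≤ b) (K : ℕ)
    (c : Fin d → Fin K → Fin b) :
    (cubeMeasure d).real ((fun x => firstDigits K (pointDigits b x)) ⁻¹' {c}) =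
      ((b : ℝ) ^ (K * d))⁻¹ := by
  have hb0 : (b : ℝ) ≠ 0 := by positivity
  have h := sum_measureReal_preimage_singleton (cubeMeasure d)
    ((measurable_firstDigits K).comp (measurable_pointDigits b d))
  have hle := fun c (_ : c ∈ Finset.univ) => cubeMeasure_digits_le (d := d) hb K c
  have hsum : ∑ _c : Fin d → Fin K → Fin b, ((b : ℝ) ^ (K * d))⁻¹ = 1 := by
    simp [pow_mul, hb0]
  exact (Finset.sum_eq_sum_iff_of_le hle).1 (h.trans hsum.symm) c (Finset.mem_univ c)

lemma integral_comp_finite {X T : Type*} [MeasurableSpace X] [Fintype T]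
    [MeasurableSpace T] [MeasurableSingletonClass T] (μ : Measure X) [IsProbabilityMeasure μ]
    {R : X → T} (hR : Measurable R) (G : T → ℝ) :
    ∫ x, G (R x) ∂μ = ∑ c, μ.real (R ⁻¹' {c}) * G c := by
  have := Measure.isProbabilityMeasure_map (μ := μ) hR.aemeasurable
  have hG : StronglyMeasurable G := (measurable_of_finite G).stronglyMeasurable
  rw [← integral_map hR.aemeasurable hG.aestronglyMeasurable, integral_fintype .of_finite]
  refine Finset.sum_congr rfl fun c _ => ?_
  rw [smul_eq_mul, map_measureReal_apply hR (measurableSet_singleton c)]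

lemma integral_comp_firstDigits_pointDigits {b d : ℕ} [NeZero b] (hb : 2 ≤ b) (K : ℕ)
    (G : (Fin d → Fin K → Fin b) → ℝ) :
    ∫ x, G (firstDigits K (pointDigits b x)) ∂(cubeMeasure d) =
      ((b : ℝ) ^ (K * d))⁻¹ * ∑ c, G c := by
  have h := integral_comp_finite (cubeMeasure d)
    ((measurable_firstDigits K).comp (measurable_pointDigits b d)) G
  simp only [Function.comp_apply] at h
  rw [h, Finset.mul_sum]
  refine Finset.sum_congr rfl fun c _ => ?_
  rw [← cubeMeasure_digits hb K c]
  rfl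

/-! ### Uniformity and second moments of scrambled points -/

section

variable {Ω : Type*} [MeasurableSpace Ω] {P : Measure Ω} [IsProbabilityMeasure P]

lemma integral_comp_firstDigits_scrambleDigits {b d : ℕ} [NeZero b] (hb : 2 ≤ b)
    {π : Fin d × List (Fin b) → Ω → Equiv.Perm (Fin b)} (hπ : IsNestedUniformScramble P b d π)
    (K : ℕ) (s : Fin d → ℕ → Fin b) (G : (Fin d → Fin K → Fin b) → ℝ) :
    ∫ ω, G (firstDigits K (scrambleDigits (fun v => π v ω) s)) ∂P =
      ((b : ℝ) ^ (K * d))⁻¹ * ∑ c, G c := by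
  have h := integral_comp_finite P
    ((measurable_firstDigits K).comp (measurable_scrambleDigits hπ.measurable s)) G
  simp only [Function.comp_apply] at h
  rw [h, Finset.mul_sum]
  refine Finset.sum_congr rfl fun c _ => ?_
  rw [← measureReal_scrambleDigits hb hπ K s (padDigits c)]
  congr 2
  ext ω
  exact firstDigits_eq_iff

lemma integral_comp_firstDigits_pair {b d : ℕ} [NeZero b] (hb : 2 ≤ b)
    {π : Fin d × List (Fin b) → Ω → Equiv.Perm (Fin b)} (hπ : IsNestedUniformScramble P b d π)
    (K : ℕ) (s s' : Fin d → ℕ → Fin b) (G : (Fin d → Fin K → Fin b) → ℝ) :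
    ∫ ω, G (firstDigits K (scrambleDigits (fun v => π v ω) s)) *
        G (firstDigits K (scrambleDigits (fun v => π v ω) s')) ∂P =
      ((b : ℝ) ^ (2 * K * d))⁻¹ * ∑ v, ∑ w, G v * G w * ∏ j, (1 + ∑ k ∈ Finset.range K,
        (b : ℝ) ^ k / ((b : ℝ) - 1) *
          (levelKernel k (s j) (s' j) * levelKernel k (padDigits v j) (padDigits w j))) := by
  have h := integral_comp_finite P
    (((measurable_firstDigits K).comp (measurable_scrambleDigits hπ.measurable s)).prodMk
      ((measurable_firstDigits K).comp (measurable_scrambleDigits hπ.measurable s')))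
    (fun c => G c.1 * G c.2)
  simp only [Function.comp_apply] at h
  rw [h, Fintype.sum_prod_type, Finset.mul_sum]
  refine Finset.sum_congr rfl fun v _ => ?_
  rw [Finset.mul_sum]
  refine Finset.sum_congr rfl fun w _ => ?_
  have h1 := measureReal_scrambleDigits_pair hb hπ K s s' (padDigits v) (padDigits w)
  have h2 : (fun ω => (firstDigits K (scrambleDigits (fun v => π v ω) s),
      firstDigits K (scrambleDigits (fun v => π v ω) s'))) ⁻¹' {(v, w)} =
      {ω | ∀ j, ∀ k < K, scrambleDigits (fun v => π v ω) s j k = padDigits v j k ∧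
        scrambleDigits (fun v => π v ω) s' j k = padDigits w j k} := by
    ext ω
    simp only [Set.mem_preimage, Set.mem_singleton_iff, Prod.mk.injEq, firstDigits_eq_iff,
      Set.mem_ofPred_eq]
    exact ⟨fun h j k hk => ⟨h.1 j k hk, h.2 j k hk⟩,
      fun h => ⟨fun j k hk => (h j k hk).1, fun j k hk => (h j k hk).2⟩⟩
  rw [h2, h1]
  ring

lemma padDigits_injective {b d K : ℕ} [NeZero b] (v w : Fin d → Fin K → Fin b)
    (h : ∀ j, ∀ l < K, padDigits v j l = padDigits w j l) : v = w := by
  ext j k : 2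
  simpa [padDigits] using h j k k.2

/-- The second moment of a sum over scrambled points, for functions of finitely many digits. -/
lemma integral_sum_firstDigits_sq_le {b n d : ℕ} [NeZero b] (hb : 2 ≤ b) (hn : 0 < n)
    {π : Fin d × List (Fin b) → Ω → Equiv.Perm (Fin b)} (hπ : IsNestedUniformScramble P b d π)
    {a : Fin n → Fin d → ℝ} (ha : ∀ i j, a i j ∈ Set.Ico (0 : ℝ) 1) {Γ : ℝ} (hΓ0 : 0 ≤ Γ)
    (hΓ : ∀ u : Finset (Fin d), u.Nonempty → ∀ κ : Fin d → ℕ, gainCoefficient b a u κ ≤ Γ)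
    (K : ℕ) (G : (Fin d → Fin K → Fin b) → ℝ) :
    ∫ ω, (∑ i, G (firstDigits K (scrambleDigits (fun v => π v ω) (pointDigits b (a i))))) ^ 2 ∂P ≤
      (n * ∫ x, G (firstDigits K (pointDigits b x)) ∂(cubeMeasure d)) ^ 2 +
        Γ * n * ∫ x, G (firstDigits K (pointDigits b x)) ^ 2 ∂(cubeMeasure d) := by
  have hb0 : (b : ℝ) ≠ 0 := by positivity
  have hmeas : ∀ i, Measurable fun ω =>
      G (firstDigits K (scrambleDigits (fun v => π v ω) (pointDigits b (a i)))) := fun i =>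
    (measurable_of_finite G).comp ((measurable_firstDigits K).comp
      (measurable_scrambleDigits hπ.measurable _))
  obtain ⟨C, hC⟩ : ∃ C, ∀ c, |G c| ≤ C := ⟨∑ c, |G c|, fun c =>
    Finset.single_le_sum (f := fun c => |G c|) (fun _ _ => abs_nonneg _) (Finset.mem_univ c)⟩
  have hint : ∀ i i', Integrable (fun ω =>
      G (firstDigits K (scrambleDigits (fun v => π v ω) (pointDigits b (a i)))) *
      G (firstDigits K (scrambleDigits (fun v => π v ω) (pointDigits b (a i'))))) P := fun i i' =>
    Integrable.of_bound ((hmeas i).mul (hmeas i')).aestronglyMeasurable (C * C)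
      (ae_of_all _ fun ω => by
        rw [Real.norm_eq_abs, abs_mul]
        exact mul_le_mul (hC _) (hC _) (abs_nonneg _) ((abs_nonneg _).trans (hC fun _ _ => 0)))
  have key := sum_pair_le hb K (fun i => pointDigits b (a i))
    (fun c : Fin d → Fin K → Fin b => padDigits c) padDigits_injective Γ hΓ0
    (fun o ho => by
      rw [Fintype.card_fin]
      exact sum_prod_extKernel_le hb hn ha hΓ ho) G
  rw [Fintype.card_fin, Fintype.card_fin] at key
  simp_rw [sq (∑ i, _), Finset.sum_mul_sum]
  rw [integral_finsetSum _ fun i _ => integrable_finsetSum _ fun i' _ => hint i i']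
  simp_rw [integral_finsetSum Finset.univ fun i' _ => hint _ i',
    integral_comp_firstDigits_pair hb hπ, ← Finset.mul_sum]
  rw [integral_comp_firstDigits_pointDigits hb K G,
    integral_comp_firstDigits_pointDigits hb K fun c => G c ^ 2]
  refine (mul_le_mul_of_nonneg_left key (by positivity)).trans_eq ?_
  rw [show 2 * K * d = K * d + K * d by ring, pow_add, mul_inv]
  field_simp

lemma measurable_scramblePoint {b d : ℕ} [NeZero b]
    {π : Fin d × List (Fin b) → Ω → Equiv.Perm (Fin b)} (hm : ∀ v, Measurable[_, ⊤] (π v))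
    (a : Fin d → ℝ) : Measurable fun ω => scramblePoint b (fun v => π v ω) a :=
  continuous_pointOfDigits.measurable.comp (measurable_scrambleDigits hm _)

/-- A continuous function at the points with the first `K` digits of uniform points. -/
lemma tendsto_integral_firstDigits_pointDigits {b d : ℕ} [NeZero b] (hb : 2 ≤ b)
    (g : (Fin d → ℝ) →ᵇ ℝ) :
    Tendsto (fun K => ∫ x, g (pointOfDigits (padDigits (firstDigits K (pointDigits b x))))
      ∂(cubeMeasure d)) atTop (𝓝 (∫ x, g x ∂(cubeMeasure d))) := by
  refine tendsto_integral_of_dominated_convergence (fun _ => ‖g‖) (fun K => ?_)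
    (integrable_const _) (fun K => ae_of_all _ fun x => g.norm_coe_le_norm _) ?_
  · exact ((measurable_of_finite
      fun c : Fin d → Fin K → Fin b => g (pointOfDigits (padDigits c))).comp
      ((measurable_firstDigits K).comp (measurable_pointDigits b d))).aestronglyMeasurable
  · filter_upwards [ae_cubeMeasure_mem d] with x hx
    have h := (g.continuous.tendsto _).comp (tendsto_pointOfDigits_firstDigits (pointDigits b x))
    rwa [pointOfDigits_pointDigits hb hx] at h

/-- For every `K` the first `K` digits have the same law as those of a uniform point. Only the
continuity of the map from digits to points is used in the limit, so scrambled strings that are not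
canonical expansions cause no trouble. -/
lemma integral_scramblePoint {b d : ℕ} [NeZero b] (hb : 2 ≤ b)
    {π : Fin d × List (Fin b) → Ω → Equiv.Perm (Fin b)} (hπ : IsNestedUniformScramble P b d π)
    (a : Fin d → ℝ) (g : (Fin d → ℝ) →ᵇ ℝ) :
    ∫ ω, g (scramblePoint b (fun v => π v ω) a) ∂P = ∫ x, g x ∂(cubeMeasure d) := by
  refine tendsto_nhds_unique ?_ (tendsto_integral_firstDigits_pointDigits hb g)
  have : ∀ K, ∫ x, g (pointOfDigits (padDigits (firstDigits K (pointDigits b x))))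
      ∂(cubeMeasure d) = ∫ ω, g (pointOfDigits (padDigits (firstDigits K
        (scrambleDigits (fun v => π v ω) (pointDigits b a))))) ∂P := fun K => by
    rw [integral_comp_firstDigits_pointDigits hb K fun c => g (pointOfDigits (padDigits c)),
      integral_comp_firstDigits_scrambleDigits hb hπ K _ fun c => g (pointOfDigits (padDigits c))]
  simp_rw [this]
  refine tendsto_integral_of_dominated_convergence (fun _ => ‖g‖) (fun K => ?_)
    (integrable_const _) (fun K => ae_of_all _ fun x => g.norm_coe_le_norm _)
    (ae_of_all _ fun ω => ?_)
  · exact ((measurable_of_finite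
      fun c : Fin d → Fin K → Fin b => g (pointOfDigits (padDigits c))).comp
      ((measurable_firstDigits K).comp
        (measurable_scrambleDigits hπ.measurable _))).aestronglyMeasurable
  · exact (g.continuous.tendsto _).comp (tendsto_pointOfDigits_firstDigits _)

/-- Every scrambled point is uniformly distributed. -/
lemma measurePreserving_scramblePoint {b d : ℕ} [NeZero b] (hb : 2 ≤ b)
    {π : Fin d × List (Fin b) → Ω → Equiv.Perm (Fin b)} (hπ : IsNestedUniformScramble P b d π)
    (a : Fin d → ℝ) :
    MeasurePreserving (fun ω => scramblePoint b (fun v => π v ω) a) P (cubeMeasure d) := by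
  have hm := measurable_scramblePoint hπ.measurable a
  refine ⟨hm, ?_⟩
  have := Measure.isProbabilityMeasure_map (μ := P) hm.aemeasurable
  refine ext_of_forall_integral_eq_of_IsFiniteMeasure fun g => ?_
  rw [integral_map hm.aemeasurable g.continuous.aestronglyMeasurable,
    integral_scramblePoint hb hπ a g]

/-- The second moment of a sum over scrambled points, for continuous functions. -/
lemma integral_sum_scramblePoint_sq_le {b n d : ℕ} [NeZero b] (hb : 2 ≤ b) (hn : 0 < n)
    {π : Fin d × List (Fin b) → Ω → Equiv.Perm (Fin b)} (hπ : IsNestedUniformScramble P b d π)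
    {a : Fin n → Fin d → ℝ} (ha : ∀ i j, a i j ∈ Set.Ico (0 : ℝ) 1) {Γ : ℝ} (hΓ0 : 0 ≤ Γ)
    (hΓ : ∀ u : Finset (Fin d), u.Nonempty → ∀ κ : Fin d → ℕ, gainCoefficient b a u κ ≤ Γ)
    (g : (Fin d → ℝ) →ᵇ ℝ) :
    ∫ ω, (∑ i, g (scramblePoint b (fun v => π v ω) (a i))) ^ 2 ∂P ≤
      (n * ∫ x, g x ∂(cubeMeasure d)) ^ 2 + Γ * n * ∫ x, g x ^ 2 ∂(cubeMeasure d) := by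
  have h1 := tendsto_integral_firstDigits_pointDigits (d := d) hb g
  have h2 := tendsto_integral_firstDigits_pointDigits (d := d) hb (g ^ 2)
  simp only [BoundedContinuousFunction.coe_pow, Pi.pow_apply] at h2
  refine le_of_tendsto_of_tendsto' ?_ (((h1.const_mul (n : ℝ)).pow 2).add
    (h2.const_mul (Γ * n))) fun K =>
      integral_sum_firstDigits_sq_le hb hn hπ ha hΓ0 hΓ K fun c => g (pointOfDigits (padDigits c))
  refine tendsto_integral_of_dominated_convergence (fun _ => (n * ‖g‖) ^ 2) (fun K => ?_)
    (integrable_const _) (fun K => ae_of_all _ fun ω => ?_) (ae_of_all _ fun ω => ?_)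
  · refine Measurable.aestronglyMeasurable (Measurable.pow_const
      (Finset.measurable_sum _ fun i _ => ?_) 2)
    exact (measurable_of_finite
      fun c : Fin d → Fin K → Fin b => g (pointOfDigits (padDigits c))).comp
      ((measurable_firstDigits K).comp (measurable_scrambleDigits hπ.measurable _))
  · rw [norm_pow]
    refine pow_le_pow_left₀ (norm_nonneg _) ?_ 2
    refine (norm_sum_le _ _).trans ((Finset.sum_le_sum fun i _ => g.norm_coe_le_norm _).trans ?_)
    simp
  · exact (tendsto_finsetSum _ fun i _ => (g.continuous.tendsto _).comp
      (tendsto_pointOfDigits_firstDigits _)).pow 2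

end

/-! ### The variance bound for square integrable functions -/

lemma eLpNorm_two_eq {X : Type*} [MeasurableSpace X] {μ : Measure X} {h : X → ℝ}
    (hh : MemLp h 2 μ) : eLpNorm h 2 μ = ENNReal.ofReal √(∫ x, h x ^ 2 ∂μ) := by
  rw [hh.eLpNorm_eq_integral_rpow_norm (by norm_num) (by norm_num)]
  simp [Real.sqrt_eq_rpow]

section

variable {Ω : Type*} [MeasurableSpace Ω] {P : Measure Ω} [IsProbabilityMeasure P]

lemma eLpNorm_sum_sub_le_of_continuous {b n d : ℕ} [NeZero b] (hb : 2 ≤ b) (hn : 0 < n)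
    {π : Fin d × List (Fin b) → Ω → Equiv.Perm (Fin b)} (hπ : IsNestedUniformScramble P b d π)
    {a : Fin n → Fin d → ℝ} (ha : ∀ i j, a i j ∈ Set.Ico (0 : ℝ) 1) {Γ : ℝ} (hΓ0 : 0 ≤ Γ)
    (hΓ : ∀ u : Finset (Fin d), u.Nonempty → ∀ κ : Fin d → ℕ, gainCoefficient b a u κ ≤ Γ)
    (g : (Fin d → ℝ) →ᵇ ℝ) :
    eLpNorm (fun ω => ∑ i, g (scramblePoint b (fun v => π v ω) (a i)) -
        n * ∫ x, g x ∂(cubeMeasure d)) 2 P ≤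
      ENNReal.ofReal √(Γ * n) * eLpNorm g 2 (cubeMeasure d) := by
  set e : ℝ := ∫ x, g x ∂(cubeMeasure d) with he
  have hgm : MemLp g 2 (cubeMeasure d) := MemLp.of_bound g.continuous.aestronglyMeasurable ‖g‖
    (ae_of_all _ fun x => g.norm_coe_le_norm x)
  have hgi : Integrable g (cubeMeasure d) := hgm.integrable (by norm_num)
  have hgi2 : Integrable (fun x => g x ^ 2) (cubeMeasure d) := hgm.integrable_sq
  -- Centring the integrand removes the squared mean from the bound.
  have key := integral_sum_scramblePoint_sq_le hb hn hπ ha hΓ0 hΓ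
    (g - BoundedContinuousFunction.const _ e)
  simp only [BoundedContinuousFunction.coe_sub, Pi.sub_apply,
    BoundedContinuousFunction.const_apply, Finset.sum_sub_distrib, Finset.sum_const,
    Finset.card_univ, Fintype.card_fin, nsmul_eq_mul] at key
  have h1 : ∫ x, (g x - e) ∂(cubeMeasure d) = 0 := by
    rw [integral_sub hgi (integrable_const _)]; simp [he]
  have h2 : ∫ x, (g x - e) ^ 2 ∂(cubeMeasure d) ≤ ∫ x, g x ^ 2 ∂(cubeMeasure d) := by
    have h3 : ∀ x, (g x - e) ^ 2 = g x ^ 2 - 2 * e * (g x - e) - e ^ 2 := fun x => by ring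
    have hi : Integrable (fun x => 2 * e * (g x - e)) (cubeMeasure d) :=
      (hgi.sub (integrable_const _)).const_mul _
    have hi' : Integrable (fun x => g x ^ 2 - 2 * e * (g x - e)) (cubeMeasure d) := hgi2.sub hi
    simp_rw [h3]
    rw [integral_sub hi' (integrable_const _), integral_sub hgi2 hi, integral_const_mul, h1]
    simp [sq_nonneg]
  rw [h1] at key
  have hm : MemLp (fun ω => ∑ i, g (scramblePoint b (fun v => π v ω) (a i)) - n * e) 2 P := by
    have hmi : ∀ i, MemLp (fun ω => g (scramblePoint b (fun v => π v ω) (a i))) 2 P := fun i =>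
      hgm.comp_measurePreserving (measurePreserving_scramblePoint hb hπ (a i))
    exact (memLp_finsetSum _ fun i _ => hmi i).sub (memLp_const _)
  rw [eLpNorm_two_eq hm, eLpNorm_two_eq hgm, ← ENNReal.ofReal_mul (Real.sqrt_nonneg _),
    ← Real.sqrt_mul (by positivity)]
  refine ENNReal.ofReal_le_ofReal (Real.sqrt_le_sqrt (key.trans ?_))
  rw [mul_zero, zero_pow two_ne_zero, zero_add]
  gcongr

lemma enorm_integral_le_eLpNorm_two {X : Type*} [MeasurableSpace X] {μ : Measure X}
    [IsProbabilityMeasure μ] {h : X → ℝ} (hh : AEStronglyMeasurable h μ) :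
    ‖∫ x, h x ∂μ‖ₑ ≤ eLpNorm h 2 μ := by
  refine (enorm_integral_le_lintegral_enorm h).trans ?_
  rw [← eLpNorm_one_eq_lintegral_enorm]
  exact eLpNorm_le_eLpNorm_of_exponent_le (by norm_num) hh

/-- A crude triangle inequality, of order `n` instead of `√n`. It serves only for the error of
approximation by continuous functions, which tends to 0 with `n` fixed. -/
lemma eLpNorm_sum_sub_le_two_mul {b n d : ℕ} [NeZero b] (hb : 2 ≤ b)
    {π : Fin d × List (Fin b) → Ω → Equiv.Perm (Fin b)} (hπ : IsNestedUniformScramble P b d π)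
    (a : Fin n → Fin d → ℝ) {h : (Fin d → ℝ) → ℝ} (hh : MemLp h 2 (cubeMeasure d)) :
    eLpNorm (fun ω => ∑ i, h (scramblePoint b (fun v => π v ω) (a i)) -
        n * ∫ x, h x ∂(cubeMeasure d)) 2 P ≤ 2 * n * eLpNorm h 2 (cubeMeasure d) := by
  have hmp := fun i => measurePreserving_scramblePoint hb hπ (a i)
  have hm : ∀ i, MemLp (fun ω => h (scramblePoint b (fun v => π v ω) (a i))) 2 P := fun i =>
    hh.comp_measurePreserving (hmp i)
  have h1 : eLpNorm (fun ω => ∑ i, h (scramblePoint b (fun v => π v ω) (a i))) 2 P ≤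
      n * eLpNorm h 2 (cubeMeasure d) := by
    have := eLpNorm_sum_le (p := 2) (μ := P) (s := Finset.univ)
      (f := fun i ω => h (scramblePoint b (fun v => π v ω) (a i)))
      (fun i _ => (hm i).aestronglyMeasurable) (by norm_num)
    have h2 : ∀ i, eLpNorm (fun ω => h (scramblePoint b (fun v => π v ω) (a i))) 2 P =
        eLpNorm h 2 (cubeMeasure d) := fun i =>
      eLpNorm_comp_measurePreserving hh.aestronglyMeasurable (hmp i)
    simp only [h2, Finset.sum_const, Finset.card_univ, Fintype.card_fin, nsmul_eq_mul] at this
    refine le_trans (le_of_eq ?_) this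
    congr 1
    ext ω
    simp
  have h2 : eLpNorm (fun _ : Ω => (n : ℝ) * ∫ x, h x ∂(cubeMeasure d)) 2 P ≤
      n * eLpNorm h 2 (cubeMeasure d) := by
    rw [eLpNorm_const _ (by norm_num) (IsProbabilityMeasure.ne_zero P)]
    have hn : ‖(n : ℝ)‖ₑ = n := by simp
    simp only [measure_univ, ENNReal.one_rpow, mul_one, enorm_mul, hn]
    gcongr
    exact enorm_integral_le_eLpNorm_two hh.aestronglyMeasurable
  refine (eLpNorm_sub_le (memLp_finsetSum _ fun i _ => hm i).aestronglyMeasurable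
    aestronglyMeasurable_const (by norm_num)).trans ((add_le_add h1 h2).trans_eq ?_)
  ring

/-- The variance bound for scrambled nets with bounded gain coefficients. -/
lemma eLpNorm_sum_sub_le {b n d : ℕ} [NeZero b] (hb : 2 ≤ b) (hn : 0 < n)
    {π : Fin d × List (Fin b) → Ω → Equiv.Perm (Fin b)} (hπ : IsNestedUniformScramble P b d π)
    {a : Fin n → Fin d → ℝ} (ha : ∀ i j, a i j ∈ Set.Ico (0 : ℝ) 1) {Γ : ℝ} (hΓ0 : 0 ≤ Γ)
    (hΓ : ∀ u : Finset (Fin d), u.Nonempty → ∀ κ : Fin d → ℕ, gainCoefficient b a u κ ≤ Γ)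
    {h : (Fin d → ℝ) → ℝ} (hh : MemLp h 2 (cubeMeasure d)) :
    eLpNorm (fun ω => ∑ i, h (scramblePoint b (fun v => π v ω) (a i)) -
        n * ∫ x, h x ∂(cubeMeasure d)) 2 P ≤
      ENNReal.ofReal √(Γ * n) * eLpNorm h 2 (cubeMeasure d) := by
  set C := ENNReal.ofReal √(Γ * n) with hC
  have key : ∀ ε : ℝ≥0∞, ε ≠ 0 → eLpNorm (fun ω => ∑ i, h (scramblePoint b (fun v => π v ω) (a i)) -
        n * ∫ x, h x ∂(cubeMeasure d)) 2 P ≤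
      C * (eLpNorm h 2 (cubeMeasure d) + ε) + 2 * n * ε := by
    intro ε hε
    obtain ⟨g, hg, hgm⟩ := hh.exists_boundedContinuous_eLpNorm_sub_le (by norm_num) hε
    have hsub : MemLp (h - ⇑g) 2 (cubeMeasure d) := hh.sub hgm
    have hdec : (fun ω => ∑ i, h (scramblePoint b (fun v => π v ω) (a i)) -
        n * ∫ x, h x ∂(cubeMeasure d)) =
        (fun ω => ∑ i, g (scramblePoint b (fun v => π v ω) (a i)) -
          n * ∫ x, g x ∂(cubeMeasure d)) +
        (fun ω => ∑ i, (h - ⇑g) (scramblePoint b (fun v => π v ω) (a i)) -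
          n * ∫ x, (h - ⇑g) x ∂(cubeMeasure d)) := by
      ext ω
      simp only [Pi.add_apply, Pi.sub_apply, Finset.sum_sub_distrib]
      rw [integral_sub (hh.integrable (by norm_num)) (hgm.integrable (by norm_num))]
      ring
    have hms : ∀ {k : (Fin d → ℝ) → ℝ}, MemLp k 2 (cubeMeasure d) → AEStronglyMeasurable
        (fun ω => ∑ i, k (scramblePoint b (fun v => π v ω) (a i)) -
          n * ∫ x, k x ∂(cubeMeasure d)) P := fun {k} hk =>
      ((memLp_finsetSum _ fun i _ => hk.comp_measurePreserving
        (measurePreserving_scramblePoint hb hπ (a i))).sub (memLp_const _)).aestronglyMeasurable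
    rw [hdec]
    refine (eLpNorm_add_le (hms hgm) (hms hsub) (by norm_num)).trans (add_le_add ?_ ?_)
    · refine (eLpNorm_sum_sub_le_of_continuous hb hn hπ ha hΓ0 hΓ g).trans ?_
      gcongr
      have : (g : (Fin d → ℝ) → ℝ) = h - (h - ⇑g) := by simp
      calc eLpNorm g 2 (cubeMeasure d) = eLpNorm (h - (h - ⇑g)) 2 (cubeMeasure d) := by rw [← this]
        _ ≤ eLpNorm h 2 (cubeMeasure d) + eLpNorm (h - ⇑g) 2 (cubeMeasure d) :=
          eLpNorm_sub_le hh.aestronglyMeasurable hsub.aestronglyMeasurable (by norm_num)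
        _ ≤ _ := by gcongr
    · refine (eLpNorm_sum_sub_le_two_mul hb hπ a hsub).trans ?_
      gcongr
  have hlim : Tendsto (fun ε : ℝ≥0∞ => C * (eLpNorm h 2 (cubeMeasure d) + ε) + 2 * n * ε)
      (𝓝[≠] 0) (𝓝 (C * eLpNorm h 2 (cubeMeasure d))) := by
    have : Tendsto (fun ε : ℝ≥0∞ => C * (eLpNorm h 2 (cubeMeasure d) + ε) + 2 * n * ε)
      (𝓝 0) (𝓝 (C * (eLpNorm h 2 (cubeMeasure d) + 0) + 2 * n * 0)) := by
      refine (ENNReal.Tendsto.const_mul (tendsto_const_nhds.add tendsto_id)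
        (Or.inr ENNReal.ofReal_ne_top)).add (ENNReal.Tendsto.const_mul tendsto_id
        (Or.inr (ENNReal.mul_ne_top (by norm_num) (ENNReal.natCast_ne_top n))))
    simp only [add_zero, mul_zero] at this
    exact this.mono_left nhdsWithin_le_nhds
  have : (𝓝[≠] (0 : ℝ≥0∞)).NeBot := inferInstance
  exact ge_of_tendsto hlim (eventually_mem_nhdsWithin.mono key)

lemma lintegral_sum_sub_sq_le {b n d : ℕ} [NeZero b] (hb : 2 ≤ b) (hn : 0 < n)
    {π : Fin d × List (Fin b) → Ω → Equiv.Perm (Fin b)} (hπ : IsNestedUniformScramble P b d π)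
    {a : Fin n → Fin d → ℝ} (ha : ∀ i j, a i j ∈ Set.Ico (0 : ℝ) 1) {Γ : ℝ} (hΓ0 : 0 ≤ Γ)
    (hΓ : ∀ u : Finset (Fin d), u.Nonempty → ∀ κ : Fin d → ℕ, gainCoefficient b a u κ ≤ Γ)
    {h : (Fin d → ℝ) → ℝ} (hh : MemLp h 2 (cubeMeasure d)) :
    ∫⁻ ω, ‖∑ i, h (scramblePoint b (fun v => π v ω) (a i)) -
        n * ∫ x, h x ∂(cubeMeasure d)‖ₑ ^ 2 ∂P ≤
      ENNReal.ofReal (Γ * n) * ∫⁻ x, ‖h x‖ₑ ^ 2 ∂(cubeMeasure d) := by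
  have key := pow_le_pow_left₀ zero_le (eLpNorm_sum_sub_le hb hn hπ ha hΓ0 hΓ hh) 2
  rw [mul_pow, ← ENNReal.ofReal_pow (Real.sqrt_nonneg _), Real.sq_sqrt (by positivity)] at key
  have e1 := eLpNorm_nnreal_pow_eq_lintegral (f := h) (μ := cubeMeasure d) (p := 2) (by norm_num)
  have e2 := eLpNorm_nnreal_pow_eq_lintegral
    (f := fun ω => ∑ i, h (scramblePoint b (fun v => π v ω) (a i)) -
        n * ∫ x, h x ∂(cubeMeasure d)) (μ := P) (p := 2) (by norm_num)
  norm_num at e1 e2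
  rwa [e1, e2] at key

end

/-! ### Truncation and almost sure convergence of block averages -/

lemma ae_tendsto_zero_of_tsum_lintegral_sq {Ω : Type*} [MeasurableSpace Ω] {P : Measure Ω}
    {Y : ℕ → Ω → ℝ} (hY : ∀ m, AEMeasurable (Y m) P)
    (h : ∑' m, ∫⁻ ω, ‖Y m ω‖ₑ ^ 2 ∂P ≠ ∞) :
    ∀ᵐ ω ∂P, Tendsto (fun m => Y m ω) atTop (𝓝 0) := by
  have hm : ∀ m, AEMeasurable (fun ω => ‖Y m ω‖ₑ ^ 2) P := fun m => (hY m).enorm.pow_const 2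
  rw [← lintegral_tsum hm] at h
  filter_upwards [ae_lt_top' (AEMeasurable.tsum hm) h] with ω hω
  have h1 := ENNReal.tendsto_atTop_zero_of_tsum_ne_top hω.ne
  have h2 := h1.ennrpow_const (1 / 2 : ℝ)
  rw [ENNReal.zero_rpow_of_pos (by norm_num)] at h2
  rw [tendsto_zero_iff_enorm_tendsto_zero]
  refine h2.congr fun m => ?_
  rw [← ENNReal.rpow_natCast, ← ENNReal.rpow_mul]
  norm_num

/-- Split the square as the powers `2 - p` and `p`; the first is bounded by the truncation height,
which requires `p ≤ 2`. -/
lemma enorm_truncation_sq_le {X : Type*} (f : X → ℝ) {p : ℝ} (hp0 : 0 ≤ p) (hp2 : p ≤ 2) (n : ℕ)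
    (x : X) : ‖truncation f n x‖ₑ ^ 2 ≤ (n : ℝ≥0∞) ^ (2 - p) * ‖f x‖ₑ ^ p := by
  have h1 : ‖truncation f n x‖ₑ ≤ n := by
    have := abs_truncation_le_bound f n x
    rw [Nat.abs_cast] at this
    rw [Real.enorm_eq_ofReal_abs, ← ENNReal.ofReal_natCast]
    exact ENNReal.ofReal_le_ofReal this
  have h2 : ‖truncation f n x‖ₑ ≤ ‖f x‖ₑ := by
    rw [Real.enorm_eq_ofReal_abs, Real.enorm_eq_ofReal_abs]
    exact ENNReal.ofReal_le_ofReal (abs_truncation_le_abs_self f n x)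
  calc ‖truncation f n x‖ₑ ^ 2 = ‖truncation f n x‖ₑ ^ ((2 - p) + p) := by
        rw [sub_add_cancel]; exact (ENNReal.rpow_natCast _ 2).symm
    _ = ‖truncation f n x‖ₑ ^ (2 - p) * ‖truncation f n x‖ₑ ^ p :=
        ENNReal.rpow_add_of_nonneg _ _ (by linarith) hp0
    _ ≤ _ := mul_le_mul' (ENNReal.rpow_le_rpow h1 (by linarith)) (ENNReal.rpow_le_rpow h2 hp0)

lemma tsum_natCast_pow_rpow_ne_top {b : ℕ} (hb : 2 ≤ b) {p : ℝ} (hp : 1 < p) :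
    ∑' m, ((b ^ m : ℕ) : ℝ≥0∞) ^ (1 - p) ≠ ∞ := by
  have h1 : ∀ m, ((b ^ m : ℕ) : ℝ≥0∞) ^ (1 - p) = ((b : ℝ≥0∞) ^ (1 - p)) ^ m := by
    intro m
    rw [Nat.cast_pow, ← ENNReal.rpow_natCast, ← ENNReal.rpow_natCast, ← ENNReal.rpow_mul,
      ← ENNReal.rpow_mul, mul_comm]
  simp_rw [h1]
  rw [ENNReal.tsum_geometric]
  have h2 : (b : ℝ≥0∞) ^ (1 - p) < 1 :=
    ENNReal.rpow_lt_one_of_one_lt_of_neg (by exact_mod_cast hb) (by linarith)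
  exact ENNReal.inv_ne_top.2 (tsub_pos_of_lt h2).ne'

section

variable {Ω : Type*} [MeasurableSpace Ω] {P : Measure Ω} [IsProbabilityMeasure P]

/-- A union bound over `n` uniformly distributed points and Markov's inequality for `|f| ^ p` at
height `n`: `n * n ^ (-p)`. -/
lemma measure_truncation_ne_le {b n d : ℕ} [NeZero b] (hb : 2 ≤ b) (hn : 0 < n)
    {π : Fin d × List (Fin b) → Ω → Equiv.Perm (Fin b)} (hπ : IsNestedUniformScramble P b d π)
    (a : Fin n → Fin d → ℝ) {p : ℝ} (hp : 1 < p) {f : (Fin d → ℝ) → ℝ}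
    (hf : AEStronglyMeasurable f (cubeMeasure d)) :
    P {ω | ∃ i, truncation f n (scramblePoint b (fun v => π v ω) (a i)) ≠
        f (scramblePoint b (fun v => π v ω) (a i))} ≤
      (∫⁻ x, ‖f x‖ₑ ^ p ∂(cubeMeasure d)) * (n : ℝ≥0∞) ^ (1 - p) := by
  have hn0 : (n : ℝ≥0∞) ≠ 0 := by exact_mod_cast hn.ne'
  have hnt : (n : ℝ≥0∞) ≠ ∞ := ENNReal.natCast_ne_top n
  let S : Set (Fin d → ℝ) := {x | (n : ℝ≥0∞) ^ p ≤ ‖f x‖ₑ ^ p}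
  have hfm : AEMeasurable (fun x => ‖f x‖ₑ ^ p) (cubeMeasure d) := hf.enorm.pow_const p
  have hS : NullMeasurableSet S (cubeMeasure d) := nullMeasurableSet_le aemeasurable_const hfm
  have hle : cubeMeasure d S ≤ (∫⁻ x, ‖f x‖ₑ ^ p ∂(cubeMeasure d)) / (n : ℝ≥0∞) ^ p :=
    meas_ge_le_lintegral_div hfm
      (ENNReal.rpow_pos (pos_iff_ne_zero.2 hn0) hnt).ne'
      (ENNReal.rpow_ne_top_of_nonneg (by linarith) hnt)
  have hsub : {ω | ∃ i, truncation f n (scramblePoint b (fun v => π v ω) (a i)) ≠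
        f (scramblePoint b (fun v => π v ω) (a i))} ⊆
      ⋃ i, (fun ω => scramblePoint b (fun v => π v ω) (a i)) ⁻¹' S := by
    rintro ω ⟨i, hi⟩
    refine Set.mem_iUnion.2 ⟨i, ?_⟩
    by_contra hcon
    refine hi (truncation_eq_self ?_)
    simp only [S, Set.mem_preimage, Set.mem_ofPred_eq, not_le] at hcon
    have h1 := (ENNReal.rpow_lt_rpow_iff (by linarith : 0 < p)).1 hcon
    rw [Real.enorm_eq_ofReal_abs, ← ENNReal.ofReal_natCast] at h1
    exact (ENNReal.ofReal_lt_ofReal_iff (by exact_mod_cast hn)).1 h1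
  calc _ ≤ P (⋃ i, (fun ω => scramblePoint b (fun v => π v ω) (a i)) ⁻¹' S) := measure_mono hsub
    _ ≤ ∑ i, P ((fun ω => scramblePoint b (fun v => π v ω) (a i)) ⁻¹' S) :=
      measure_iUnion_fintype_le _ _
    _ = n * cubeMeasure d S := by
      simp_rw [fun i => (measurePreserving_scramblePoint hb hπ (a i)).measure_preimage hS]
      simp
    _ ≤ n * ((∫⁻ x, ‖f x‖ₑ ^ p ∂(cubeMeasure d)) / (n : ℝ≥0∞) ^ p) := by gcongr
    _ = _ := by
      rw [sub_eq_add_neg, ENNReal.rpow_add _ _ hn0 hnt, ENNReal.rpow_one, ENNReal.rpow_neg,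
        div_eq_mul_inv]
      ring

lemma lintegral_average_truncation_le {b n d : ℕ} [NeZero b] (hb : 2 ≤ b) (hn : 0 < n)
    {π : Fin d × List (Fin b) → Ω → Equiv.Perm (Fin b)} (hπ : IsNestedUniformScramble P b d π)
    {a : Fin n → Fin d → ℝ} (ha : ∀ i j, a i j ∈ Set.Ico (0 : ℝ) 1) {Γ : ℝ} (hΓ0 : 0 ≤ Γ)
    (hΓ : ∀ u : Finset (Fin d), u.Nonempty → ∀ κ : Fin d → ℕ, gainCoefficient b a u κ ≤ Γ)
    {p : ℝ} (hp : 1 < p) (hp2 : p ≤ 2) {f : (Fin d → ℝ) → ℝ}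
    (hf : AEStronglyMeasurable f (cubeMeasure d)) :
    ∫⁻ ω, ‖(∑ i, truncation f n (scramblePoint b (fun v => π v ω) (a i))) / n -
        ∫ x, truncation f n x ∂(cubeMeasure d)‖ₑ ^ 2 ∂P ≤
      ENNReal.ofReal Γ * (∫⁻ x, ‖f x‖ₑ ^ p ∂(cubeMeasure d)) * (n : ℝ≥0∞) ^ (1 - p) := by
  have hn0 : (n : ℝ≥0∞) ≠ 0 := by exact_mod_cast hn.ne'
  have hnr : (n : ℝ) ≠ 0 := by exact_mod_cast hn.ne'
  have hnt : (n : ℝ≥0∞) ≠ ∞ := ENNReal.natCast_ne_top n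
  have key := lintegral_sum_sub_sq_le hb hn hπ ha hΓ0 hΓ (hf.memLp_truncation (A := n) (p := 2))
  have h1 : ∀ ω, ‖(∑ i, truncation f n (scramblePoint b (fun v => π v ω) (a i))) / n -
        ∫ x, truncation f n x ∂(cubeMeasure d)‖ₑ ^ 2 =
      ((n : ℝ≥0∞)⁻¹) ^ 2 * ‖∑ i, truncation f n (scramblePoint b (fun v => π v ω) (a i)) -
        n * ∫ x, truncation f n x ∂(cubeMeasure d)‖ₑ ^ 2 := by
    intro ω
    rw [← mul_pow]
    congr 1
    have : (n : ℝ≥0∞)⁻¹ = ‖(n : ℝ)⁻¹‖ₑ := by rw [enorm_inv hnr]; simp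
    rw [this, ← enorm_mul, mul_sub, inv_mul_cancel_left₀ hnr, div_eq_inv_mul]
  simp_rw [h1]
  rw [lintegral_const_mul' _ _ (ENNReal.pow_ne_top (ENNReal.inv_ne_top.2 hn0))]
  have h2 : ∫⁻ x, ‖truncation f n x‖ₑ ^ 2 ∂(cubeMeasure d) ≤
      (n : ℝ≥0∞) ^ (2 - p) * ∫⁻ x, ‖f x‖ₑ ^ p ∂(cubeMeasure d) := by
    rw [← lintegral_const_mul' _ _ (ENNReal.rpow_ne_top_of_nonneg (by linarith) hnt)]
    exact lintegral_mono fun x => enorm_truncation_sq_le f (by linarith) hp2 n x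
  calc _ ≤ ((n : ℝ≥0∞)⁻¹) ^ 2 * (ENNReal.ofReal (Γ * n) *
        ((n : ℝ≥0∞) ^ (2 - p) * ∫⁻ x, ‖f x‖ₑ ^ p ∂(cubeMeasure d))) := by
        gcongr
        exact key.trans (by gcongr)
    _ = _ := by
      rw [ENNReal.ofReal_mul hΓ0, ENNReal.ofReal_natCast, show 1 - p = (2 - p) + (-1) by ring,
        ENNReal.rpow_add _ _ hn0 hnt, ENNReal.rpow_neg_one]
      calc _ = ENNReal.ofReal Γ * (∫⁻ x, ‖f x‖ₑ ^ p ∂(cubeMeasure d)) *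
            ((n : ℝ≥0∞) ^ (2 - p) * (n : ℝ≥0∞)⁻¹) * ((n : ℝ≥0∞) * (n : ℝ≥0∞)⁻¹) := by ring
        _ = _ := by rw [ENNReal.mul_inv_cancel hn0 hnt, mul_one]

/-- The averages over the `r`-th blocks of `b ^ m` points converge. -/
lemma ae_tendsto_block_average {b t d : ℕ} [NeZero b] (hb : 2 ≤ b)
    {π : Fin d × List (Fin b) → Ω → Equiv.Perm (Fin b)} (hπ : IsNestedUniformScramble P b d π)
    {a : ℕ → Fin d → ℝ} (ha : ∀ i j, a i j ∈ Set.Ico (0 : ℝ) 1) {Γ : ℝ} (hΓ0 : 0 ≤ Γ)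
    (hΓ : GainBoundedBy b t d a Γ) {p : ℝ} (hp : 1 < p) (hp2 : p ≤ 2)
    {f : (Fin d → ℝ) → ℝ} (hf : MemLp f (ENNReal.ofReal p) (cubeMeasure d)) (r : ℕ) :
    ∀ᵐ ω ∂P, Tendsto (fun m : ℕ =>
      (∑ i : Fin (b ^ m), f (scramblePoint b (fun v => π v ω) (block b m r a i))) /
        ((b ^ m : ℕ) : ℝ)) atTop (𝓝 (∫ x, f x ∂(cubeMeasure d))) := by
  have hpos : ∀ m, 0 < b ^ m := fun m => pow_pos (by omega) m
  have hfi : Integrable f (cubeMeasure d) := hf.integrable (by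
    rw [ENNReal.one_le_ofReal]; exact hp.le)
  have hfm := hf.aestronglyMeasurable
  have hB : ∫⁻ x, ‖f x‖ₑ ^ p ∂(cubeMeasure d) ≠ ∞ := by
    have := lintegral_rpow_enorm_lt_top_of_eLpNorm_lt_top
      (by simp; linarith) ENNReal.ofReal_ne_top hf.eLpNorm_lt_top
    rw [ENNReal.toReal_ofReal (by linarith)] at this
    exact this.ne
  have hsum : ∀ C : ℝ≥0∞, C ≠ ∞ → ∑' m, C * ((b ^ (m + t) : ℕ) : ℝ≥0∞) ^ (1 - p) ≠ ∞ := by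
    intro C hC
    rw [ENNReal.tsum_mul_left]
    refine ENNReal.mul_ne_top hC (ne_top_of_le_ne_top (tsum_natCast_pow_rpow_ne_top hb hp) ?_)
    exact ENNReal.tsum_comp_le_tsum_of_injective (add_left_injective t)
      fun m => ((b ^ m : ℕ) : ℝ≥0∞) ^ (1 - p)
  -- The shift by `t` confines attention to `m ≥ t`, where the gain coefficients are bounded.
  have h1 : ∀ᵐ ω ∂P, Tendsto (fun m : ℕ => (∑ i : Fin (b ^ (m + t)), truncation f (b ^ (m + t) : ℕ)
      (scramblePoint b (fun v => π v ω) (block b (m + t) r a i))) / ((b ^ (m + t) : ℕ) : ℝ) -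
        ∫ x, truncation f (b ^ (m + t) : ℕ) x ∂(cubeMeasure d)) atTop (𝓝 0) := by
    refine ae_tendsto_zero_of_tsum_lintegral_sq (fun m => ?_) (ne_top_of_le_ne_top
      (hsum _ (ENNReal.mul_ne_top ENNReal.ofReal_ne_top hB)) (ENNReal.tsum_le_tsum fun m =>
        lintegral_average_truncation_le hb (hpos _) hπ (fun i j => ha _ j) hΓ0
          (hΓ (m + t) (by omega) r) hp hp2 hfm))
    have hmi : ∀ i, AEMeasurable (fun ω => truncation f (b ^ (m + t) : ℕ)
        (scramblePoint b (fun v => π v ω) (block b (m + t) r a i))) P := fun i =>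
      (hfm.truncation.aemeasurable).comp_quasiMeasurePreserving
        (measurePreserving_scramblePoint hb hπ _).quasiMeasurePreserving
    exact ((Finset.aemeasurable_fun_sum _ fun i _ => hmi i).div_const _).sub_const _
  -- Borel–Cantelli: almost surely truncation changes no sampled value in all but finitely many
  -- blocks.
  have h2 : ∀ᵐ ω ∂P, ∀ᶠ m in atTop, ω ∉ {ω | ∃ i : Fin (b ^ (m + t)),
      truncation f (b ^ (m + t) : ℕ)
        (scramblePoint b (fun v => π v ω) (block b (m + t) r a i)) ≠
      f (scramblePoint b (fun v => π v ω) (block b (m + t) r a i))} :=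
    ae_eventually_notMem (ne_top_of_le_ne_top (hsum _ hB) (ENNReal.tsum_le_tsum fun m =>
      measure_truncation_ne_le hb (hpos _) hπ _ hp hfm))
  have h3 : Tendsto (fun m : ℕ => ∫ x, truncation f (b ^ (m + t) : ℕ) x ∂(cubeMeasure d)) atTop
      (𝓝 (∫ x, f x ∂(cubeMeasure d))) := by
    refine (tendsto_integral_truncation hfi).comp (tendsto_natCast_atTop_atTop.comp ?_)
    exact (tendsto_pow_atTop_atTop_of_one_lt (by omega)).comp (tendsto_add_atTop_nat t)
  filter_upwards [h1, h2] with ω hω1 hω2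
  rw [← tendsto_add_atTop_iff_nat t]
  have h4 := hω1.add h3
  simp only [sub_add_cancel, zero_add] at h4
  refine h4.congr' ?_
  filter_upwards [hω2] with m hm
  simp only [not_exists, not_not] at hm
  simp only [hm]

end

/-! ### From blocks to all sample sizes -/

lemma tendsto_sum_range_mul_pow {b : ℕ} {u : ℕ → ℝ} {l : ℝ}
    (h : ∀ r : ℕ, Tendsto (fun m : ℕ => (∑ i : Fin (b ^ m), u (r * b ^ m + i)) / ((b ^ m : ℕ) : ℝ))
      atTop (𝓝 l)) {R : ℕ} (hR : 0 < R) :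
    Tendsto (fun m : ℕ => (∑ i ∈ Finset.range (R * b ^ m), u i) / ((R * b ^ m : ℕ) : ℝ))
      atTop (𝓝 l) := by
  have h1 : ∀ R : ℕ, Tendsto (fun m : ℕ => (∑ i ∈ Finset.range (R * b ^ m), u i) /
      ((b ^ m : ℕ) : ℝ)) atTop (𝓝 (R * l)) := by
    intro R
    induction R with
    | zero => simp
    | succ R ih =>
      have := ih.add (h R)
      rw [show ((R + 1 : ℕ) : ℝ) * l = R * l + l by push_cast; ring]
      refine this.congr fun m => ?_
      rw [← add_div, add_mul, one_mul, Finset.sum_range_add, Fin.sum_univ_eq_sum_range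
        (fun i => u (R * b ^ m + i))]
  have hR' : (R : ℝ) ≠ 0 := by exact_mod_cast hR.ne'
  have := (h1 R).div_const (R : ℝ)
  rw [mul_div_cancel_left₀ _ hR'] at this
  refine this.congr fun m => ?_
  rw [div_div, Nat.cast_mul, mul_comm (R : ℝ)]

/-- Since partial sums are monotone, it suffices that for every `α > 1` the averages converge along
some sizes tending to infinity with consecutive ratios at most `α`. -/
lemma tendsto_average_of_tendsto_block {b : ℕ} (hb : 2 ≤ b) {u : ℕ → ℝ} (hu : ∀ i, 0 ≤ u i)
    {l : ℝ} (h : ∀ r : ℕ, Tendsto (fun m : ℕ => (∑ i : Fin (b ^ m), u (r * b ^ m + i)) /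
      ((b ^ m : ℕ) : ℝ)) atTop (𝓝 l)) :
    Tendsto (fun n : ℕ => (∑ i ∈ Finset.range n, u i) / n) atTop (𝓝 l) := by
  refine tendsto_div_of_monotone_of_exists_subseq_tendsto_div
    (fun n => ∑ i ∈ Finset.range n, u i) l
    (fun m n hmn => Finset.sum_le_sum_of_subset_of_nonneg (Finset.range_mono hmn)
      fun i _ _ => hu i) fun α hα => ?_
  -- This makes `1 + 1 / B < α`, and `(R + 1) / R ≤ 1 + 1 / B` for `R ≥ B`.
  obtain ⟨B, hB⟩ := exists_nat_gt (1 / (α - 1))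
  have hα' : 0 < α - 1 := by linarith
  have hB0 : 0 < B := by
    have : (0 : ℝ) < B := lt_trans (by positivity) hB
    exact_mod_cast this
  set Q := B * (b - 1) with hQ
  have hQ0 : 0 < Q := Nat.mul_pos hB0 (by omega)
  have hBQ : B + Q = B * b := by
    obtain ⟨e, rfl⟩ : ∃ e, b = e + 1 := ⟨b - 1, by omega⟩
    simp [hQ, mul_add, add_comm]
  -- The sizes `R * b ^ m` with `B ≤ R < B * b`, in increasing order. There are `Q` of them for each
  -- `m`, and the next one is `B * b * b ^ m = B * b ^ (m + 1)`.
  refine ⟨fun n => (B + n % Q) * b ^ (n / Q), ?_, ?_, ?_⟩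
  · refine Eventually.of_forall fun n => ?_
    have hstep : (B + (n + 1) % Q) * b ^ ((n + 1) / Q) = (B + n % Q + 1) * b ^ (n / Q) := by
      have hlt := Nat.mod_lt n hQ0
      have hn := Nat.div_add_mod n Q
      rcases Nat.lt_or_ge (n % Q + 1) Q with hc | hc
      · have e : n + 1 = n % Q + 1 + Q * (n / Q) := by omega
        have e1 : (n + 1) % Q = n % Q + 1 := by
          rw [e, Nat.add_mul_mod_self_left, Nat.mod_eq_of_lt hc]
        have e2 : (n + 1) / Q = n / Q := by
          rw [e, Nat.add_mul_div_left _ _ hQ0, Nat.div_eq_of_lt hc, zero_add]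
        rw [e1, e2, add_assoc]
      · have e0 : n % Q + 1 = Q := by omega
        have e : n + 1 = Q * (n / Q + 1) := by rw [mul_add, mul_one]; omega
        have e1 : (n + 1) % Q = 0 := by rw [e, Nat.mul_mod_right]
        have e2 : (n + 1) / Q = n / Q + 1 := by rw [e, Nat.mul_div_cancel_left _ hQ0]
        rw [e1, e2, add_assoc, e0, hBQ, add_zero, pow_succ]
        ring
    beta_reduce
    rw [hstep]
    push_cast
    rw [← mul_assoc]
    refine mul_le_mul_of_nonneg_right ?_ (by positivity)
    have h1 : 1 < B * (α - 1) := by rwa [div_lt_iff₀ hα'] at hB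
    have h2 : (0 : ℝ) ≤ ((n % Q : ℕ) : ℝ) := Nat.cast_nonneg _
    nlinarith
  · refine tendsto_atTop_mono (fun n => ?_)
      ((tendsto_pow_atTop_atTop_of_one_lt (r := b) (by omega)).comp
        (Nat.tendsto_div_const_atTop hQ0.ne'))
    exact Nat.le_mul_of_pos_left _ (by omega)
  · rw [Metric.tendsto_atTop']
    intro ε hε
    -- Only the finitely many multipliers `B + s` occur, so their limits hold with a common
    -- threshold in `m`.
    have h1 : ∀ s ∈ Finset.range Q, ∀ᶠ m : ℕ in atTop,
        dist ((∑ i ∈ Finset.range ((B + s) * b ^ m), u i) / (((B + s) * b ^ m : ℕ) : ℝ)) l < ε :=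
      fun s _ => (tendsto_sum_range_mul_pow h (by omega : 0 < B + s)).eventually
        (Metric.ball_mem_nhds l hε)
    have h2 := (Nat.tendsto_div_const_atTop hQ0.ne').eventually
      ((Finset.eventually_all _).2 h1)
    obtain ⟨N, hN⟩ := eventually_atTop.1 h2
    exact ⟨N, fun n hn => hN n hn.le _ (Finset.mem_range.2 (Nat.mod_lt n hQ0))⟩

/-! ### The strong law -/

section

variable {Ω : Type*} [MeasurableSpace Ω] {P : Measure Ω} [IsProbabilityMeasure P]

lemma ae_tendsto_average_of_nonneg {b t d : ℕ} [NeZero b] (hb : 2 ≤ b)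
    {π : Fin d × List (Fin b) → Ω → Equiv.Perm (Fin b)} (hπ : IsNestedUniformScramble P b d π)
    {a : ℕ → Fin d → ℝ} (ha : ∀ i j, a i j ∈ Set.Ico (0 : ℝ) 1) {Γ : ℝ} (hΓ0 : 0 ≤ Γ)
    (hΓ : GainBoundedBy b t d a Γ) {p : ℝ} (hp : 1 < p) (hp2 : p ≤ 2)
    {f : (Fin d → ℝ) → ℝ} (hf0 : ∀ x, 0 ≤ f x)
    (hf : MemLp f (ENNReal.ofReal p) (cubeMeasure d)) :
    ∀ᵐ ω ∂P, Tendsto (fun n : ℕ =>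
      (∑ i ∈ Finset.range n, f (scramblePoint b (fun v => π v ω) (a i))) / n)
      atTop (𝓝 (∫ x, f x ∂(cubeMeasure d))) := by
  -- There are countably many block indices `r`, so one null set serves them all.
  filter_upwards [ae_all_iff.2 (ae_tendsto_block_average hb hπ ha hΓ0 hΓ hp hp2 hf)] with ω hω
  exact tendsto_average_of_tendsto_block hb (fun i => hf0 _) hω

lemma ae_tendsto_sampleMean {b t d : ℕ} [NeZero b] (hb : 2 ≤ b)
    {π : Fin d × List (Fin b) → Ω → Equiv.Perm (Fin b)} (hπ : IsNestedUniformScramble P b d π)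
    {a : ℕ → Fin d → ℝ} (ha : ∀ i j, a i j ∈ Set.Ico (0 : ℝ) 1) {Γ : ℝ} (hΓ0 : 0 ≤ Γ)
    (hΓ : GainBoundedBy b t d a Γ) {p : ℝ} (hp : 1 < p) (hp2 : p ≤ 2)
    {f : (Fin d → ℝ) → ℝ} (hf : MemLp f (ENNReal.ofReal p) (cubeMeasure d)) :
    ∀ᵐ ω ∂P, Tendsto (fun n : ℕ => sampleMean f
        (fun i => scramblePoint b (fun v => π v ω) (a i)) n)
      atTop (𝓝 (∫ x, f x ∂(cubeMeasure d))) := by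
  have h1p : 1 ≤ ENNReal.ofReal p := by rw [ENNReal.one_le_ofReal]; exact hp.le
  have hpos : MemLp (fun x => max (f x) 0) (ENNReal.ofReal p) (cubeMeasure d) := hf.pos_part
  have hneg : MemLp (fun x => max (-f x) 0) (ENNReal.ofReal p) (cubeMeasure d) := hf.neg_part
  have hdec : ∀ x, f x = max (f x) 0 - max (-f x) 0 := fun x =>
    (max_zero_sub_max_neg_zero_eq_self (f x)).symm
  have hint : ∫ x, f x ∂(cubeMeasure d) =
      ∫ x, max (f x) 0 ∂(cubeMeasure d) - ∫ x, max (-f x) 0 ∂(cubeMeasure d) := by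
    rw [← integral_sub (hpos.integrable h1p) (hneg.integrable h1p)]
    exact integral_congr_ae (ae_of_all _ hdec)
  filter_upwards [ae_tendsto_average_of_nonneg hb hπ ha hΓ0 hΓ hp hp2
      (fun x => le_max_right _ _) hpos,
    ae_tendsto_average_of_nonneg hb hπ ha hΓ0 hΓ hp hp2
      (fun x => le_max_right _ _) hneg] with ω h1 h2
  rw [hint]
  refine (h1.sub h2).congr fun n => ?_
  rw [sampleMean, ← sub_div, ← Finset.sum_sub_distrib]
  simp_rw [← hdec]

end

end ScrambledNet

theorem theorem3 {Ω : Type*} [MeasurableSpace Ω] (P : Measure Ω) [IsProbabilityMeasure P]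
    (b t d : ℕ) [NeZero b] (hb : 2 ≤ b) (hd : 1 ≤ d)
    -- a `(t, d)`-sequence in base `b` whose gain coefficients are at most `Γ`
    (a : ℕ → Fin d → ℝ) (ha : ScrambledNet.IsDigitalSequence b t d a)
    (Γ : ℝ) (hΓ : ScrambledNet.GainBoundedBy b t d a Γ)
    -- the random permutations of the nested uniform scramble
    (π : Fin d × List (Fin b) → Ω → Equiv.Perm (Fin b))
    (hπ : ScrambledNet.IsNestedUniformScramble P b d π)
    -- the integrand, in `L^p` of the unit cube
    (p : ℝ) (hp : 1 < p) (f : (Fin d → ℝ) → ℝ)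
    (hf : MemLp f (ENNReal.ofReal p) (volume.restrict (Set.Icc (0 : Fin d → ℝ) 1))) :
    ∀ᵐ ω ∂P, Tendsto
      (fun n : ℕ => ScrambledNet.sampleMean f
        (fun i => ScrambledNet.scramblePoint b (fun v => π v ω) (a i)) n)
      atTop (𝓝 (∫ x in Set.Icc (0 : Fin d → ℝ) 1, f x)) := by
  -- On a probability space the exponent may be lowered to `min p 2`, which still exceeds 1.
  -- Likewise Γ is raised to `max Γ 0` to make it nonnegative.
  have hf' : MemLp f (ENNReal.ofReal (min p 2)) (ScrambledNet.cubeMeasure d) :=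
    MemLp.mono_exponent (μ := ScrambledNet.cubeMeasure d) hf
      (ENNReal.ofReal_le_ofReal (min_le_left p 2))
  exact ScrambledNet.ae_tendsto_sampleMean hb hπ ha.1 (le_max_right Γ 0)
    (fun m hm r u hu κ => (hΓ m hm r u hu κ).trans (le_max_left Γ 0))
    (lt_min hp one_lt_two) (min_le_right p 2) hf'
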